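/- Let $L$ be a finite, nonempty relational language in which every relation symbol has arity at least $2$, and let $\overline\alpha : L \to (0,1)\cap\mathbb{Q}$. Let $K_L$ be the class of finite (possibly empty) $L$-structures in which every $E\in L$ is symmetric and irreflexive (tuples satisfying $E$ have no repetitions). For $\mathfrak A\in K_L$ let $N_E(\mathfrak A)$ be the number of subsets of $A$ on which $E$ holds, and put $$\delta(\mathfrak A)=|A|-\sum_{E\in L}\overline\alpha(E)\,N_E(\mathfrak A),\qquad K_{\overline\alpha}=\{\mathfrak A\in K_L:\delta(\mathfrak A')\ge 0\text{ for all }\mathfrak A'\subseteq\mathfrak A\}.$$ For finite $\mathfrak A\subseteq\mathfrak B$ write $\mathfrak A\le\mathfrak B$ if $\delta(\mathfrak A)\le\delta(\mathfrak A')$ whenever $\mathfrak A\subseteq\mathfrak A'\subseteq\mathfrak B$; for a finite substructure $\mathfrak A$ of an arbitrary structure $\mathfrak M$ all of whose finite substructures lie in $K_L$, write $\mathfrak A\le\mathfrak M$ if $\mathfrak A\le\mathfrak B$ for every finite $\mathfrak B$ with $\mathfrak A\subseteq\mathfrak B\subseteq\mathfrak M$. An embedding is strong if its image is $\le$ the target.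 Let $S_{\overline\alpha}$ be the first-order theory stating that every finite substructure is in $K_{\overline\alpha}$ and that, for all $\mathfrak A\le\mathfrak B$ in $K_{\overline\alpha}$, every embedding of $\mathfrak A$ into the model extends to an embedding of $\mathfrak B$. For $\mathfrak M\models S_{\overline\alpha}$ let $\dim(\mathfrak M)=\max\{\delta(\mathfrak B):\mathfrak B\le\mathfrak M \text{ finite}\}$, and $\dim(\mathfrak M)=\infty$ if there is no maximum. Let $c$ be the least common multiple of the denominators (in lowest terms) of the values $\overline\alpha(E)$, and for an integer $k\ge0$ let $K_{k/c}=\{\mathfrak A\in K_{\overline\alpha}:\delta(\mathfrak A)=k/c\}$. For a subclass $C\subseteq K_{\overline\alpha}$, $(C,\le)$ is a Fraïssé class if it has joint embedding and amalgamation with respect to strong embeddings. A countable structure $\mathfrak M$, all of whose finite substructures are in $K_{\overline\alpha}$, is the generic of $(C,\le)$ if $\mathfrak M$ is the union of a chain $\mathfrak A_0\le\mathfrak A_1\le\cdots$ of members of $C$, and whenever $\mathfrak A\le\mathfrak B$ are in $C$ and $\mathfrak A\le\mathfrak M$, there is a strong embedding of $\mathfrak B$ into $\mathfrak M$ over $\mathfrak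 A$. The generic of $(K_{\overline\alpha},\le)$ is called the Baldwin–Shi hypergraph (or generic) for $\overline\alpha$. **Theorem.** 1. If $\mathfrak M,\mathfrak N$ are countable models of $S_{\overline\alpha}$, then $\mathfrak M\cong\mathfrak N$ if and only if $\dim(\mathfrak M)=\dim(\mathfrak N)$. 2. For a countable model $\mathfrak M$ of $S_{\overline\alpha}$, $\dim(\mathfrak M)=\infty$ if and only if $\mathfrak M$ is the generic of $(K_{\overline\alpha},\le)$. 3. Up to isomorphism, $S_{\overline\alpha}$ has exactly $\aleph_0$ models of cardinality $\aleph_0$. 4. Every countable model $\mathfrak M$ of $S_{\overline\alpha}$ is the generic of a Fraïssé class $(C,\le)$ with $C\subseteq K_{\overline\alpha}$: if $\dim(\mathfrak M)=\infty$ one can take $C=K_{\overline\alpha}$; otherwise $\dim(\mathfrak M)=k/c$ for some integer $k\ge 0$ and one can take $C=K_{k/c}$. -/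

import Mathlib

open FirstOrder CategoryTheory

universe u v w

namespace BaldwinShi

noncomputable section

variable {L : FirstOrder.Language.{u, v}}

/-- Every relation symbol is interpreted irreflexively (no tuple with a repetition satisfies it)
and symmetrically. -/
def IsHypergraph (L : FirstOrder.Language.{u, v}) (M : Type w) [L.Structure M] : Prop :=
  ∀ (n : ℕ) (E : L.Relations n) (x : Fin n → M), Language.Structure.RelMap E x →
    Function.Injective x ∧ ∀ σ : Equiv.Perm (Fin n), Language.Structure.RelMap E (x ∘ σ)

/-- `N_E(X)`: the number of subsets of the finite set `X` on which `E` holds. -/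
def numEdges {M : Type w} [L.Structure M] (E : Σ n, L.Relations n) (X : Finset M) : ℕ :=
  {s : Set M | s ⊆ (X : Set M) ∧
    ∃ x : Fin E.1 → M, Language.Structure.RelMap E.2 x ∧ Set.range x = s}.ncard

variable [Fintype (Σ n, L.Relations n)] (α : (Σ n, L.Relations n) → ℚ)

/-- The rank `δ` of the finite substructure with universe `X`.
(`L` is relational, so the substructures of `M` are its subsets.) -/
def delta {M : Type w} [L.Structure M] (X : Finset M) : ℚ :=
  (X.card : ℚ) - ∑ E : (Σ n, L.Relations n), α E * (numEdges E X : ℚ)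

/-- The structures all of whose finite substructures are hypergraphs of rank at least `0`. -/
def InKBar (M : Type w) [L.Structure M] : Prop :=
  IsHypergraph L M ∧ ∀ X : Finset M, 0 ≤ delta α X

/-- The class `K_α`: finite hypergraphs in which every substructure has rank at least `0`. -/
def K : Set (Bundled.{0} L.Structure) :=
  {A | Finite A ∧ InKBar α A}

/-- `X ≤ Y` for finite substructures `X`, `Y` of a common structure. -/
def StrongPair {M : Type w} [L.Structure M] (X Y : Finset M) : Prop :=
  X ⊆ Y ∧ ∀ Z : Finset M, X ⊆ Z → Z ⊆ Y → delta α X ≤ delta α Z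

/-- `X ≤ M` for a finite substructure `X` of `M`. -/
def StrongIn {M : Type w} [L.Structure M] (X : Finset M) : Prop :=
  ∀ Y : Finset M, X ⊆ Y → StrongPair α X Y

/-- `f` is a strong embedding: its image is finite and strong in `M`. -/
def IsStrongEmb {A : Type*} {M : Type*} [L.Structure A] [L.Structure M] (f : A ↪[L] M) : Prop :=
  ∃ X : Finset M, (X : Set M) = Set.range f ∧ StrongIn α X

/-! ### The theory `S_α` -/

/-- The atomic diagram `Δ_A` of a finite structure `A`, in variables indexed by `A`. -/
def diagram (A : Type) [L.Structure A] [Finite A] : L.Formula A :=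
  open Classical in
  (Language.Formula.iInf fun p : A × A =>
    if p.1 = p.2 then ⊤ else ∼(Language.Term.equal (.var p.1) (.var p.2))) ⊓
  (Language.Formula.iInf fun q : (Σ E : (Σ n, L.Relations n), Fin E.1 → A) =>
    if Language.Structure.RelMap q.1.2 q.2
    then q.1.2.formula fun i => .var (q.2 i)
    else ∼(q.1.2.formula fun i => .var (q.2 i)))

/-- The sentence `¬ ∃ x̄, Δ_A(x̄)`: no substructure is isomorphic to `A`. -/
def omits (A : Type) [L.Structure A] [Finite A] : L.Sentence :=
  ∼(Language.Formula.iExs A ((diagram (L := L) A).relabel Sum.inr))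

/-- The sentence `∀ x̄ (Δ_A(x̄) → ∃ ȳ (Δ_B(ȳ) ∧ ȳ extends x̄ along e))`. -/
def extends_ {A B : Type} [L.Structure A] [L.Structure B] [Finite A] [Finite B]
    (e : A ↪[L] B) : L.Sentence :=
  Language.Formula.iAlls A
    (((diagram (L := L) A).relabel Sum.inr).imp
      (Language.Formula.iExs B
        (((diagram (L := L) B).relabel Sum.inr) ⊓
          Language.Formula.iInf fun a : A =>
            Language.Term.equal (.var (Sum.inr (e a))) (.var (Sum.inl (Sum.inr a))))))

/-- The theory `S_α`: every finite substructure is in `K_α`, and whenever `A ≤ B` are in `K_α`,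
every embedding of `A` extends to an embedding of `B`. -/
def S : L.Theory :=
  {φ | ∃ (A : Bundled.{0} L.Structure) (_ : Finite A), A ∉ K α ∧ φ = omits A} ∪
  {φ | ∃ (A B : Bundled.{0} L.Structure) (_ : Finite A) (_ : Finite B) (e : A ↪[L] B),
    A ∈ K α ∧ B ∈ K α ∧ IsStrongEmb α e ∧ φ = extends_ e}

theorem exists_emb_of_diagram [L.IsRelational] {A : Type} [L.Structure A] [Finite A]
    {M : Type w} [L.Structure M] (x : A → M) :
    (diagram (L := L) A).Realize x ↔ ∃ f : A ↪[L] M, ⇑f = x := by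
  classical
  rw [diagram, Language.Formula.realize_inf, Language.Formula.realize_iInf,
    Language.Formula.realize_iInf]
  constructor
  · rintro ⟨h1, h2⟩
    refine ⟨⟨⟨x, ?_⟩, fun f => isEmptyElim f, ?_⟩, rfl⟩
    · intro a b hab
      by_contra hne
      simpa [hne, hab, Language.Formula.realize_equal] using h1 (a, b)
    · intro n r y
      have := h2 ⟨⟨n, r⟩, y⟩
      by_cases h : Language.Structure.RelMap r y <;>
        simpa [h, Language.Formula.realize_rel, Function.comp_def] using this
  · rintro ⟨f, rfl⟩
    refine ⟨?_, ?_⟩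
    · rintro ⟨a, b⟩
      by_cases h : a = b <;> simp [h, Language.Formula.realize_equal]
    · rintro ⟨⟨n, r⟩, y⟩
      by_cases h : Language.Structure.RelMap r y
      · simpa [h, Language.Formula.realize_rel, Function.comp_def] using
          (f.map_rel r y).2 h
      · simpa [h, Language.Formula.realize_rel, Function.comp_def] using
          fun h' => h ((f.map_rel r y).1 h')

/-- The models of `S_α` are exactly the structures described by the two requirements. -/
theorem models_S_iff [L.IsRelational] (M : Type w) [L.Structure M] :
    M ⊨ S α ↔
      (∀ A : Bundled.{0} L.Structure, Finite A → Nonempty (A ↪[L] M) → A ∈ K α) ∧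
      (∀ A B : Bundled.{0} L.Structure, A ∈ K α → B ∈ K α → ∀ e : A ↪[L] B, IsStrongEmb α e →
        ∀ f : A ↪[L] M, ∃ g : B ↪[L] M, g.comp e = f) := by
  have homits : ∀ (A : Bundled.{0} L.Structure) (_ : Finite A),
      M ⊨ omits (L := L) A ↔ ¬ Nonempty (A ↪[L] M) := by
    intro A _
    rw [omits, Language.Sentence.Realize, Language.Formula.realize_not,
      Language.Formula.realize_iExs]
    simp only [Language.Formula.realize_relabel, Sum.elim_comp_inr, exists_emb_of_diagram]
    exact not_congr ⟨fun ⟨_, f, _⟩ => ⟨f⟩, fun ⟨f⟩ => ⟨_, f, rfl⟩⟩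
  have hext : ∀ (A B : Bundled.{0} L.Structure) (_ : Finite A) (_ : Finite B) (e : A ↪[L] B),
      M ⊨ extends_ e ↔ ∀ f : A ↪[L] M, ∃ g : B ↪[L] M, g.comp e = f := by
    intro A B _ _ e
    rw [extends_, Language.Sentence.Realize, Language.Formula.realize_iAlls]
    simp only [Language.Formula.realize_imp, Language.Formula.realize_iExs,
      Language.Formula.realize_inf, Language.Formula.realize_relabel, Function.comp_def,
      Sum.elim_inr, Language.Formula.realize_iInf, Language.Formula.realize_equal,
      Language.Term.realize_var, Sum.elim_inl, exists_emb_of_diagram]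
    constructor
    · intro h f
      obtain ⟨_, ⟨g, hgx⟩, hg⟩ := h f ⟨f, rfl⟩
      exact ⟨g, Language.Embedding.ext fun a => (congrFun hgx (e a)).trans (hg a)⟩
    · rintro h x ⟨f, hf⟩
      obtain ⟨g, rfl⟩ := h f
      exact ⟨g, ⟨g, rfl⟩, fun a => congrFun hf a⟩
  rw [Language.Theory.model_iff]
  constructor
  · intro h
    refine ⟨fun A hA hf => ?_, fun A B hA hB e he => ?_⟩
    · by_contra hK
      exact (homits A hA).1 (h _ (Or.inl ⟨A, hA, hK, rfl⟩)) hf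
    · exact (hext A B hA.1 hB.1 e).1 (h _ (Or.inr ⟨A, B, hA.1, hB.1, e, hA, hB, he, rfl⟩))
  · rintro ⟨h1, h2⟩ φ (⟨A, hA, hK, rfl⟩ | ⟨A, B, _, _, e, hA, hB, he, rfl⟩)
    · exact (homits A hA).2 fun hf => hK (h1 A hA hf)
    · exact (hext A B _ _ e).2 (h2 A B hA hB e he)

/-! ### Dimension -/

/-- `dim(M/A)`: the maximum of `δ(B) - δ(A)` over finite `B` with `A ≤ B ≤ M`,
and `∞` if there is no maximum. -/
def relDim {M : Type w} [L.Structure M] (A : Finset M) : WithTop ℚ :=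
  open Classical in
  if h : ∃ d : ℚ, IsGreatest
      {q | ∃ B : Finset M, StrongPair α A B ∧ StrongIn α B ∧ q = delta α B - delta α A} d
  then (h.choose : WithTop ℚ) else ⊤

/-- `dim(M) = dim(M/∅)`. -/
def dim (M : Type w) [L.Structure M] : WithTop ℚ :=
  relDim α (∅ : Finset M)

/-! ### Subclasses of `(K_α, ≤)` and their generics -/

/-- `c`, the least common multiple of the (reduced) denominators of the values of `α`. -/
def commonDenom : ℕ :=
  Finset.univ.lcm fun E => (α E).den

/-- The class `K_{k/c}` of the structures in `K_α` of rank `k/c`. -/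
def KRank (k : ℕ) : Set (Bundled.{0} L.Structure) :=
  {A | A ∈ K α ∧ ∃ X : Finset A, (∀ a, a ∈ X) ∧ delta α X = (k : ℚ) / (commonDenom α : ℚ)}

/-- `(C, ≤)` is a Fraïssé class: joint embedding and amalgamation with respect to `≤`. -/
structure IsFraisseClass (C : Set (Bundled.{0} L.Structure)) : Prop where
  joint_embedding : ∀ A ∈ C, ∀ B ∈ C, ∃ D ∈ C, ∃ (f : A ↪[L] D) (g : B ↪[L] D),
    IsStrongEmb α f ∧ IsStrongEmb α g
  amalgamation : ∀ A ∈ C, ∀ B₁ ∈ C, ∀ B₂ ∈ C, ∀ (f₁ : A ↪[L] B₁) (f₂ : A ↪[L] B₂),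
    IsStrongEmb α f₁ → IsStrongEmb α f₂ →
    ∃ D ∈ C, ∃ (g₁ : B₁ ↪[L] D) (g₂ : B₂ ↪[L] D),
      IsStrongEmb α g₁ ∧ IsStrongEmb α g₂ ∧ g₁.comp f₁ = g₂.comp f₂

/-- The finite substructure with universe `X` is (isomorphic to) a member of `C`. -/
def IsMember (C : Set (Bundled.{0} L.Structure)) {M : Type w} [L.Structure M]
    (X : Finset M) : Prop :=
  ∃ A ∈ C, ∃ f : A ↪[L] M, Set.range f = (X : Set M)

/-- `M` is the generic of the subclass `(C, ≤)` of `(K_α, ≤)`. By `chain`, every finite subset of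
`M` lies in a finite `B ≤ M` with `B` in `C`. -/
structure IsGeneric (C : Set (Bundled.{0} L.Structure)) (M : Type w) [L.Structure M] : Prop where
  countable : Countable M
  mem_KBar : InKBar α M
  chain : ∃ A : ℕ → Finset M, (∀ i, IsMember C (A i)) ∧ (∀ i, StrongPair α (A i) (A (i + 1))) ∧
    ∀ x : M, ∃ i, x ∈ A i
  extension : ∀ A ∈ C, ∀ B ∈ C, ∀ e : A ↪[L] B, IsStrongEmb α e →
    ∀ f : A ↪[L] M, IsStrongEmb α f → ∃ g : B ↪[L] M, IsStrongEmb α g ∧ g.comp e = f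

/-- The models of `S_α` of cardinality `ℵ₀` (in a fixed universe), up to isomorphism. -/
def countableModelsSetoid : Setoid
    {M : Bundled.{w} L.Structure // Cardinal.mk M = Cardinal.aleph0 ∧ M ⊨ S α} :=
  (Language.equivSetoid (L := L)).comap Subtype.val

end

end BaldwinShi

/-!
The proof rests on free amalgamation and on lowering the rank.

*Free amalgamation.* The rank is submodular, and modular on free amalgams
(`EdgeFamily.IsFreeSquare.rank_add`). So if `A ≤ B` and `A ⊆ C` are in `K_α`, then the free amalgam
`D` of `B` and `C` over `A` is in `K_α`, has rank `δ(B) + δ(C) - δ(A)`, and satisfies `C ≤ D`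
(`exists_freeAmalgam`).

*Lowering the rank* (`exists_lower`). For `F`, `C` in `K_α` some extension `D ⊇ F` in `K_α` has
rank exactly `δ(C)`, and every `X ≤ F` with `δ(X) ≤ δ(C)` satisfies `X ≤ D`. To see this, fix a
relation symbol with weight `p / q` in lowest terms. Adding to a large structure a chain of new
vertices, each tied by hyperedges to its predecessor and to other earlier vertices, the relative
rank runs through `0, q, 2q, …` modulo `p`, in units of `1 / q`. Between consecutive stages it stays
in `[0, p / q)`, so that a set missing one of the hyperedges always has larger rank than the whole
chain; once all old vertices are tied, the chain is stopped at relative rank `-1 / q`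
(`EdgeFamily.exists_extension_rank_sub`). As disjoint copies of `F` and of `C` and isolated points
bring the rank to `δ(C)` plus a natural number, iterating this step gives the claim.

*Models.* Let `M` be a countable model of the theory. If its dimension is `k / c`, then its strong
finite substructures of rank `k / c` are cofinal, and an extension of one of them inside `M` without
change of rank is again strong, so `M` is the generic of `K_{k/c}` (`isGeneric_KRank_of_models`).
If the dimension is infinite, then `A ≤ M` lies in some `C ≤ M` of rank at least `δ(B)`, and the
free amalgam of `B` and `C` over `A`, lowered to the rank of `C`, embeds strongly over `C`, so `M`
is the generic of `K_α` (`isGeneric_K_of_models`). Both classes have joint embedding (by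
lowering the rank of a disjoint union, in the case of `K_{k/c}`), so that their generics are unique
by a back-and-forth argument (`nonempty_equiv_of_isGeneric`).

*Counting.* There are at most countably many dimensions. Conversely every natural number `n` is the
dimension of a countable model (`exists_model_dim_eq`), the limit of a sufficiently generic sequence
of finite structures of rank `n`, ordered by `≤`: any extension required by the theory can be
realized by a free amalgam lowered to rank `n`.
-/

namespace BaldwinShi

section

/-! ### Edge families and their rank -/

/-- A family of hypergraphs on the vertex set `V`, one for each label in `ι`, given by their sets
of hyperedges. -/
abbrev EdgeFamily (ι : Type*) (V : Type*) := ι → Set (Finset V)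

namespace EdgeFamily

variable {ι A B C D V W : Type*}

open Classical in
/-- The number of hyperedges with label `E` inside `X`. -/
noncomputable def count (H : EdgeFamily ι V) (E : ι) (X : Finset V) : ℕ :=
  (X.powerset.filter (· ∈ H E)).card

/-- The rank `|X| - ∑ α(E) N_E(X)`. -/
noncomputable def rank [Fintype ι] (α : ι → ℚ) (H : EdgeFamily ι V) (X : Finset V) : ℚ :=
  (X.card : ℚ) - ∑ E, α E * (count H E X : ℚ)

/-- Every hyperedge with label `E` has `ar E` vertices. -/
def Uniform (ar : ι → ℕ) (H : EdgeFamily ι V) : Prop :=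
  ∀ E, ∀ s ∈ H E, s.card = ar E

/-- `f` embeds `H` into `H'` as an induced family of hypergraphs. -/
def IsEmb (H : EdgeFamily ι V) (H' : EdgeFamily ι W) (f : V ↪ W) : Prop :=
  ∀ E s, s.map f ∈ H' E ↔ s ∈ H E

theorem count_add_le [DecidableEq V] (H : EdgeFamily ι V) (E : ι) (X Y : Finset V) :
    count H E X + count H E Y ≤ count H E (X ∪ Y) + count H E (X ∩ Y) := by
  classical
  unfold count
  rw [← Finset.card_union_add_card_inter]
  refine add_le_add (Finset.card_le_card ?_) (Finset.card_le_card ?_)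
  · intro s
    simp only [Finset.mem_union, Finset.mem_filter, Finset.mem_powerset]
    rintro (⟨h, h'⟩ | ⟨h, h'⟩)
    · exact ⟨h.trans Finset.subset_union_left, h'⟩
    · exact ⟨h.trans Finset.subset_union_right, h'⟩
  · intro s
    simp only [Finset.mem_inter, Finset.mem_filter, Finset.mem_powerset, Finset.subset_inter_iff]
    tauto

theorem rank_submodular [Fintype ι] [DecidableEq V] {α : ι → ℚ} (hα : ∀ E, 0 ≤ α E)
    (H : EdgeFamily ι V) (X Y : Finset V) :
    rank α H (X ∪ Y) + rank α H (X ∩ Y) ≤ rank α H X + rank α H Y := by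
  have h1 : ((X ∪ Y).card : ℚ) + (X ∩ Y).card = X.card + Y.card := by
    exact_mod_cast Finset.card_union_add_card_inter X Y
  have h2 : ∑ E, α E * (count H E X : ℚ) + ∑ E, α E * (count H E Y : ℚ) ≤
      ∑ E, α E * (count H E (X ∪ Y) : ℚ) + ∑ E, α E * (count H E (X ∩ Y) : ℚ) := by
    rw [← Finset.sum_add_distrib, ← Finset.sum_add_distrib]
    refine Finset.sum_le_sum fun E _ => ?_
    rw [← mul_add, ← mul_add]
    exact mul_le_mul_of_nonneg_left (by exact_mod_cast count_add_le H E X Y) (hα E)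
  unfold rank
  linarith

theorem count_map {H : EdgeFamily ι V} {H' : EdgeFamily ι W} {f : V ↪ W} {E : ι} {X : Finset V}
    (hf : ∀ s ⊆ X, s.map f ∈ H' E ↔ s ∈ H E) : count H' E (X.map f) = count H E X := by
  classical
  unfold count
  rw [← Finset.card_map (Finset.mapEmbedding f).toEmbedding]
  congr 1
  ext s
  simp only [Finset.mem_filter, Finset.mem_powerset, Finset.mem_map, Finset.subset_map_iff,
    RelEmbedding.coe_toEmbedding, Finset.mapEmbedding_apply]
  constructor
  · rintro ⟨⟨t, ht, rfl⟩, h⟩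
    exact ⟨t, ⟨ht, (hf t ht).1 h⟩, rfl⟩
  · rintro ⟨t, ⟨ht, h⟩, rfl⟩
    exact ⟨⟨t, ht, rfl⟩, (hf t ht).2 h⟩

theorem rank_map_of_subset [Fintype ι] (α : ι → ℚ) {H : EdgeFamily ι V} {H' : EdgeFamily ι W}
    {f : V ↪ W} {X : Finset V} (hf : ∀ E, ∀ s ⊆ X, s.map f ∈ H' E ↔ s ∈ H E) :
    rank α H' (X.map f) = rank α H X := by
  unfold rank
  simp only [fun E => count_map (hf E), Finset.card_map]

theorem rank_map [Fintype ι] (α : ι → ℚ) {H : EdgeFamily ι V} {H' : EdgeFamily ι W} {f : V ↪ W}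
    (hf : IsEmb H H' f) (X : Finset V) : rank α H' (X.map f) = rank α H X :=
  rank_map_of_subset α fun E s _ => hf E s

theorem rank_empty [Fintype ι] (α : ι → ℚ) {ar : ι → ℕ} (har : ∀ E, 2 ≤ ar E)
    {H : EdgeFamily ι V} (hH : Uniform ar H) : rank α H ∅ = 0 := by
  classical
  have : ∀ E, count H E ∅ = 0 := by
    intro E
    unfold count
    rw [Finset.card_eq_zero, Finset.filter_eq_empty_iff]
    intro s hs h
    have h1 := hH E s h
    have h2 := har E
    simp only [Finset.powerset_empty, Finset.mem_singleton] at hs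
    subst hs
    simp at h1
    omega
  simp [rank, this]

/-! ### Free amalgams -/

/-- The hyperedges of `HB` and of `HC`, transported to a common vertex set. -/
def glue (i : B ↪ D) (j : C ↪ D) (HB : EdgeFamily ι B) (HC : EdgeFamily ι C) :
    EdgeFamily ι D :=
  fun E => {s | (∃ t ∈ HB E, t.map i = s) ∨ ∃ t ∈ HC E, t.map j = s}

theorem glue_comm (i : B ↪ D) (j : C ↪ D) (HB : EdgeFamily ι B) (HC : EdgeFamily ι C) :
    glue i j HB HC = glue j i HC HB := by
  funext E
  ext s
  exact or_comm

theorem Uniform.glue {ar : ι → ℕ} {HB : EdgeFamily ι B} {HC : EdgeFamily ι C}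
    (hB : Uniform ar HB) (hC : Uniform ar HC) (i : B ↪ D) (j : C ↪ D) :
    Uniform ar (glue i j HB HC) := by
  rintro E s (⟨t, ht, rfl⟩ | ⟨t, ht, rfl⟩)
  · rw [Finset.card_map, hB E t ht]
  · rw [Finset.card_map, hC E t ht]

/-- A commuting square of injections in which the images of `B` and `C` meet only in the image
of `A` and together cover `D`. -/
structure IsFreeSquare (f : A ↪ B) (g : A ↪ C) (i : B ↪ D) (j : C ↪ D) : Prop where
  comm : ∀ a, i (f a) = j (g a)
  inter : ∀ b c, i b = j c → ∃ a, f a = b ∧ g a = c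
  cover : ∀ d, (∃ b, i b = d) ∨ ∃ c, j c = d

theorem IsFreeSquare.symm {f : A ↪ B} {g : A ↪ C} {i : B ↪ D} {j : C ↪ D}
    (h : IsFreeSquare f g i j) : IsFreeSquare g f j i where
  comm a := (h.comm a).symm
  inter c b hcb := by
    obtain ⟨a, ha, ha'⟩ := h.inter b c hcb.symm
    exact ⟨a, ha', ha⟩
  cover d := (h.cover d).symm

theorem IsFreeSquare.exists_map {f : A ↪ B} {g : A ↪ C} {i : B ↪ D} {j : C ↪ D}
    (h : IsFreeSquare f g i j) {s : Finset B} {t : Finset C} (hst : s.map i = t.map j) :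
    ∃ r : Finset A, r.map f = s ∧ r.map g = t := by
  classical
  refine ⟨s.preimage f f.injective.injOn, ?_, ?_⟩
  · ext b
    simp only [Finset.mem_map, Finset.mem_preimage]
    constructor
    · rintro ⟨a, ha, rfl⟩
      exact ha
    · intro hb
      have : i b ∈ t.map j := hst ▸ Finset.mem_map_of_mem i hb
      obtain ⟨c, hc, hcb⟩ := Finset.mem_map.1 this
      obtain ⟨a, rfl, -⟩ := h.inter b c hcb.symm
      exact ⟨a, hb, rfl⟩
  · ext c
    simp only [Finset.mem_map, Finset.mem_preimage]
    constructor
    · rintro ⟨a, ha, rfl⟩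
      have : i (f a) ∈ t.map j := hst ▸ Finset.mem_map_of_mem i ha
      rw [h.comm] at this
      exact (Finset.mem_map' j).1 this
    · intro hc
      have : j c ∈ s.map i := hst ▸ Finset.mem_map_of_mem j hc
      obtain ⟨b, hb, hbc⟩ := Finset.mem_map.1 this
      obtain ⟨a, rfl, rfl⟩ := h.inter b c hbc
      exact ⟨a, hb, rfl⟩

theorem IsFreeSquare.isEmb_left {f : A ↪ B} {g : A ↪ C} {i : B ↪ D} {j : C ↪ D}
    (h : IsFreeSquare f g i j) {HA : EdgeFamily ι A} {HB : EdgeFamily ι B} {HC : EdgeFamily ι C}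
    (hf : IsEmb HA HB f) (hg : IsEmb HA HC g) : IsEmb HB (glue i j HB HC) i := by
  intro E s
  constructor
  · rintro (⟨t, ht, hts⟩ | ⟨t, ht, hts⟩)
    · rwa [← Finset.map_injective i hts]
    · obtain ⟨r, rfl, rfl⟩ := h.exists_map hts.symm
      exact (hf E r).2 ((hg E r).1 ht)
  · exact fun hs => Or.inl ⟨s, hs, rfl⟩

theorem IsFreeSquare.isEmb_right {f : A ↪ B} {g : A ↪ C} {i : B ↪ D} {j : C ↪ D}
    (h : IsFreeSquare f g i j) {HA : EdgeFamily ι A} {HB : EdgeFamily ι B} {HC : EdgeFamily ι C}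
    (hf : IsEmb HA HB f) (hg : IsEmb HA HC g) : IsEmb HC (glue i j HB HC) j := by
  rw [glue_comm]
  exact h.symm.isEmb_left hg hf

/-- The part of `Z` in the domain of the injection `f`. -/
noncomputable def pull (f : V ↪ W) (Z : Finset W) : Finset V :=
  Z.preimage f f.injective.injOn

@[simp] theorem mem_pull {f : V ↪ W} {Z : Finset W} {a : V} : a ∈ pull f Z ↔ f a ∈ Z :=
  Finset.mem_preimage

theorem pull_trans {U : Type*} (f : V ↪ W) (g : W ↪ U) (Z : Finset U) :
    pull (f.trans g) Z = pull f (pull g Z) := by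
  ext a
  simp

theorem subset_pull {f : V ↪ W} {X : Finset V} {Z : Finset W} : X ⊆ pull f Z ↔ X.map f ⊆ Z := by
  rw [Finset.map_subset_iff_subset_preimage]
  rfl

theorem IsFreeSquare.card_add {f : A ↪ B} {g : A ↪ C} {i : B ↪ D} {j : C ↪ D}
    (h : IsFreeSquare f g i j) (Z : Finset D) :
    Z.card + (pull (f.trans i) Z).card = (pull i Z).card + (pull j Z).card := by
  classical
  symm
  rw [← Finset.card_map (f.trans i), ← Finset.card_map i, ← Finset.card_map j,
    ← Finset.card_union_add_card_inter]
  symm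
  congr 2
  · ext d
    simp only [Finset.mem_union, Finset.mem_map, mem_pull]
    constructor
    · intro hd
      rcases h.cover d with ⟨b, rfl⟩ | ⟨c, rfl⟩
      · exact Or.inl ⟨b, hd, rfl⟩
      · exact Or.inr ⟨c, hd, rfl⟩
    · rintro (⟨b, hb, rfl⟩ | ⟨c, hc, rfl⟩) <;> assumption
  · ext d
    simp only [Finset.mem_inter, Finset.mem_map, mem_pull]
    constructor
    · rintro ⟨a, ha, rfl⟩
      exact ⟨⟨f a, ha, rfl⟩, ⟨g a, by rw [← h.comm]; exact ha, (h.comm a).symm⟩⟩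
    · rintro ⟨⟨b, hb, rfl⟩, ⟨c, hc, hcb⟩⟩
      obtain ⟨a, rfl, -⟩ := h.inter b c hcb.symm
      exact ⟨a, hb, rfl⟩

theorem IsFreeSquare.count_add {f : A ↪ B} {g : A ↪ C} {i : B ↪ D} {j : C ↪ D}
    (h : IsFreeSquare f g i j) {HA : EdgeFamily ι A} {HB : EdgeFamily ι B} {HC : EdgeFamily ι C}
    (hf : IsEmb HA HB f) (hg : IsEmb HA HC g) (E : ι) (Z : Finset D) :
    count (glue i j HB HC) E Z + count HA E (pull (f.trans i) Z) =
      count HB E (pull i Z) + count HC E (pull j Z) := by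
  classical
  unfold count
  symm
  rw [← Finset.card_map (Finset.mapEmbedding (f.trans i)).toEmbedding,
    ← Finset.card_map (Finset.mapEmbedding i).toEmbedding,
    ← Finset.card_map (Finset.mapEmbedding j).toEmbedding,
    ← Finset.card_union_add_card_inter]
  symm
  congr 2
  · ext s
    simp only [Finset.mem_union, Finset.mem_map, Finset.mem_filter, Finset.mem_powerset,
      RelEmbedding.coe_toEmbedding, Finset.mapEmbedding_apply, subset_pull]
    constructor
    · rintro ⟨hs, ⟨t, ht, rfl⟩ | ⟨t, ht, rfl⟩⟩
      · exact Or.inl ⟨t, ⟨hs, ht⟩, rfl⟩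
      · exact Or.inr ⟨t, ⟨hs, ht⟩, rfl⟩
    · rintro (⟨t, ⟨hs, ht⟩, rfl⟩ | ⟨t, ⟨hs, ht⟩, rfl⟩)
      · exact ⟨hs, Or.inl ⟨t, ht, rfl⟩⟩
      · exact ⟨hs, Or.inr ⟨t, ht, rfl⟩⟩
  · have hcomm : f.trans i = g.trans j := by
      ext a
      exact h.comm a
    ext s
    simp only [Finset.mem_inter, Finset.mem_map, Finset.mem_filter, Finset.mem_powerset,
      RelEmbedding.coe_toEmbedding, Finset.mapEmbedding_apply, subset_pull]
    constructor
    · rintro ⟨r, ⟨hr, hrA⟩, rfl⟩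
      refine ⟨⟨r.map f, ⟨?_, (hf E r).2 hrA⟩, ?_⟩, ⟨r.map g, ⟨?_, (hg E r).2 hrA⟩, ?_⟩⟩
      · rwa [Finset.map_map]
      · rw [Finset.map_map]
      · rwa [Finset.map_map, ← hcomm]
      · rw [Finset.map_map, ← hcomm]
    · rintro ⟨⟨s, ⟨hs, hsB⟩, rfl⟩, ⟨t, ⟨ht, htC⟩, hts⟩⟩
      obtain ⟨r, rfl, rfl⟩ := h.exists_map hts.symm
      refine ⟨r, ⟨?_, (hf E r).1 hsB⟩, ?_⟩
      · rwa [← Finset.map_map]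
      · rw [← Finset.map_map]

/-- The rank is modular on free amalgams. -/
theorem IsFreeSquare.rank_add [Fintype ι] (α : ι → ℚ) {f : A ↪ B} {g : A ↪ C} {i : B ↪ D}
    {j : C ↪ D} (h : IsFreeSquare f g i j) {HA : EdgeFamily ι A} {HB : EdgeFamily ι B}
    {HC : EdgeFamily ι C} (hf : IsEmb HA HB f) (hg : IsEmb HA HC g) (Z : Finset D) :
    rank α (glue i j HB HC) Z + rank α HA (pull (f.trans i) Z) =
      rank α HB (pull i Z) + rank α HC (pull j Z) := by
  have h1 : (Z.card : ℚ) + (pull (f.trans i) Z).card = (pull i Z).card + (pull j Z).card := by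
    exact_mod_cast h.card_add Z
  have h2 : ∑ E, α E * (count (glue i j HB HC) E Z : ℚ) +
      ∑ E, α E * (count HA E (pull (f.trans i) Z) : ℚ) =
      ∑ E, α E * (count HB E (pull i Z) : ℚ) + ∑ E, α E * (count HC E (pull j Z) : ℚ) := by
    rw [← Finset.sum_add_distrib, ← Finset.sum_add_distrib]
    refine Finset.sum_congr rfl fun E _ => ?_
    rw [← mul_add, ← mul_add]
    congr 1
    exact_mod_cast h.count_add hf hg E Z
  unfold rank
  linarith

/-- Any two injections with a common domain are the top and left sides of a free square. -/
theorem exists_isFreeSquare {A B C : Type} [Finite B] [Finite C] (f : A ↪ B) (g : A ↪ C) :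
    ∃ (D : Type) (_ : Finite D) (i : B ↪ D) (j : C ↪ D), IsFreeSquare f g i j := by
  classical
  let j : C → B ⊕ {c : C // c ∉ Set.range g} := fun c =>
    if h : c ∈ Set.range g then Sum.inl (f h.choose) else Sum.inr ⟨c, h⟩
  have hj : ∀ a, j (g a) = Sum.inl (f a) := by
    intro a
    have h : g a ∈ Set.range g := ⟨a, rfl⟩
    simp only [j, dif_pos h]
    rw [g.injective h.choose_spec]
  have hj' : ∀ c (h : c ∉ Set.range g), j c = Sum.inr ⟨c, h⟩ := by
    intro c h
    simp only [j, dif_neg h]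
  have hinj : Function.Injective j := by
    intro c c' hcc
    by_cases h : c ∈ Set.range g <;> by_cases h' : c' ∈ Set.range g
    · obtain ⟨a, rfl⟩ := h
      obtain ⟨a', rfl⟩ := h'
      rw [hj, hj] at hcc
      rw [f.injective (Sum.inl_injective hcc)]
    · obtain ⟨a, rfl⟩ := h
      rw [hj, hj' c' h'] at hcc
      cases hcc
    · obtain ⟨a', rfl⟩ := h'
      rw [hj, hj' c h] at hcc
      cases hcc
    · rw [hj' c h, hj' c' h'] at hcc
      exact congrArg Subtype.val (Sum.inr_injective hcc)
  refine ⟨_, inferInstance, ⟨Sum.inl, Sum.inl_injective⟩, ⟨j, hinj⟩, ?_, ?_, ?_⟩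
  · exact fun a => (hj a).symm
  · intro b c hbc
    change Sum.inl b = j c at hbc
    by_cases h : c ∈ Set.range g
    · obtain ⟨a, rfl⟩ := h
      rw [hj] at hbc
      exact ⟨a, (Sum.inl_injective hbc).symm, rfl⟩
    · rw [hj' c h] at hbc
      cases hbc
  · rintro (b | ⟨c, hc⟩)
    · exact Or.inl ⟨b, rfl⟩
    · exact Or.inr ⟨c, hj' c hc⟩

/-! ### Adding a vertex -/

/-- A new vertex `none`, and the new hyperedges `{none} ∪ t`, `t ∈ S`, with label `E₀`. -/
def addVertex (H : EdgeFamily ι V) (E₀ : ι) (S : Finset (Finset V)) : EdgeFamily ι (Option V) :=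
  fun E => {s | (∃ t ∈ H E, t.map Function.Embedding.some = s) ∨
    (E = E₀ ∧ ∃ t ∈ S, Finset.insertNone t = s)}

theorem Uniform.addVertex {ar : ι → ℕ} {H : EdgeFamily ι V} (hH : Uniform ar H) {E₀ : ι}
    {S : Finset (Finset V)} (hS : ∀ t ∈ S, t.card + 1 = ar E₀) :
    Uniform ar (addVertex H E₀ S) := by
  rintro E s (⟨t, ht, rfl⟩ | ⟨rfl, t, ht, rfl⟩)
  · rw [Finset.card_map, hH E t ht]
  · rw [Finset.card_insertNone, hS t ht]

theorem isEmb_addVertex (H : EdgeFamily ι V) (E₀ : ι) (S : Finset (Finset V)) :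
    IsEmb H (addVertex H E₀ S) Function.Embedding.some := by
  intro E s
  constructor
  · rintro (⟨t, ht, hts⟩ | ⟨rfl, t, ht, hts⟩)
    · rwa [← Finset.map_injective _ hts]
    · have : none ∈ s.map Function.Embedding.some := hts ▸ Finset.none_mem_insertNone
      simp at this
  · exact fun hs => Or.inl ⟨s, hs, rfl⟩

theorem count_addVertex [DecidableEq V] [DecidableEq ι] (H : EdgeFamily ι V) (E₀ : ι)
    (S : Finset (Finset V)) (E : ι) (Z : Finset (Option V)) :
    count (addVertex H E₀ S) E Z = count H E (Finset.eraseNone Z) +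
      if none ∈ Z ∧ E = E₀ then (S.filter (· ⊆ Finset.eraseNone Z)).card else 0 := by
  classical
  have hinj : Function.Injective (Finset.insertNone : Finset V → Finset (Option V)) :=
    fun s t hst => by rw [← Finset.eraseNone_insertNone s, hst, Finset.eraseNone_insertNone]
  have h1 : count H E (Finset.eraseNone Z) =
      (((Finset.eraseNone Z).powerset.filter (· ∈ H E)).map
        (Finset.mapEmbedding Function.Embedding.some).toEmbedding).card := by
    rw [Finset.card_map]
    rfl
  have h2 : (if none ∈ Z ∧ E = E₀ then (S.filter (· ⊆ Finset.eraseNone Z)).card else 0) =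
      (if none ∈ Z ∧ E = E₀ then (S.filter (· ⊆ Finset.eraseNone Z)).map ⟨_, hinj⟩
        else ∅).card := by
    split_ifs <;> simp
  rw [h1, h2, ← Finset.card_union_of_disjoint]
  · unfold count
    congr 1
    ext s
    simp only [Finset.mem_union, Finset.mem_map, Finset.mem_filter, Finset.mem_powerset,
      RelEmbedding.coe_toEmbedding, Finset.mapEmbedding_apply]
    constructor
    · rintro ⟨hs, ⟨t, ht, rfl⟩ | ⟨rfl, t, ht, rfl⟩⟩
      · refine Or.inl ⟨t, ⟨fun v hv => ?_, ht⟩, rfl⟩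
        rw [Finset.mem_eraseNone]
        exact hs (Finset.mem_map_of_mem Function.Embedding.some hv)
      · right
        rw [if_pos ⟨hs Finset.none_mem_insertNone, rfl⟩]
        refine Finset.mem_map.2 ⟨t, Finset.mem_filter.2 ⟨ht, fun v hv => ?_⟩, rfl⟩
        rw [Finset.mem_eraseNone]
        exact hs (Finset.some_mem_insertNone.2 hv)
    · rintro (⟨t, ⟨ht, htE⟩, rfl⟩ | hs)
      · refine ⟨fun v hv => ?_, Or.inl ⟨t, htE, rfl⟩⟩
        obtain ⟨v, hvt, rfl⟩ := Finset.mem_map.1 hv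
        exact Finset.mem_eraseNone.1 (ht hvt)
      · split_ifs at hs with hc
        · obtain ⟨t, ht, rfl⟩ := Finset.mem_map.1 hs
          obtain ⟨htS, ht⟩ := Finset.mem_filter.1 ht
          refine ⟨fun v hv => ?_, Or.inr ⟨hc.2, t, htS, rfl⟩⟩
          rcases v with _ | v
          · exact hc.1
          · exact Finset.mem_eraseNone.1 (ht (Finset.some_mem_insertNone.1 hv))
        · simp at hs
  · rw [Finset.disjoint_left]
    intro s hs hs'
    split_ifs at hs' with hc
    · obtain ⟨t, -, rfl⟩ := Finset.mem_map.1 hs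
      obtain ⟨t', -, ht'⟩ := Finset.mem_map.1 hs'
      have : none ∈ t.map Function.Embedding.some := by
        have h := Finset.none_mem_insertNone (s := t')
        change Finset.insertNone t' = _ at ht'
        rw [ht'] at h
        exact h
      simp at this
    · simp at hs'

theorem rank_addVertex [Fintype ι] [DecidableEq V] (α : ι → ℚ) (H : EdgeFamily ι V) (E₀ : ι)
    (S : Finset (Finset V)) (Z : Finset (Option V)) :
    rank α (addVertex H E₀ S) Z = rank α H (Finset.eraseNone Z) +
      if none ∈ Z then 1 - α E₀ * ((S.filter (· ⊆ Finset.eraseNone Z)).card : ℚ) else 0 := by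
  classical
  unfold rank
  simp only [count_addVertex]
  by_cases hZ : none ∈ Z
  · have hc : Z.card = (Finset.eraseNone Z).card + 1 := by
      rw [Finset.card_eraseNone_eq_card_erase, Finset.card_erase_of_mem hZ]
      have := Finset.card_pos.2 ⟨_, hZ⟩
      omega
    simp only [hZ, true_and, if_true, hc, Nat.cast_add, mul_add, Finset.sum_add_distrib,
      Nat.cast_ite, Nat.cast_zero, mul_ite, mul_zero, Finset.sum_ite_eq', Finset.mem_univ]
    push_cast
    ring
  · have hc : Z.card = (Finset.eraseNone Z).card := by
      rw [Finset.card_eraseNone_eq_card_erase, Finset.erase_eq_of_notMem hZ]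
    simp [hZ, hc]

end EdgeFamily

end

section

namespace EdgeFamily

/-! ### Extensions of smaller rank -/

theorem add_one_le_choose (j k : ℕ) : j + 1 ≤ (k + 1 + j).choose (k + 1) := by
  induction j with
  | zero => simp
  | succ j ih =>
    have h1 : 0 < (k + 1 + j).choose k := Nat.choose_pos (by omega)
    have h2 : (k + 1 + (j + 1)).choose (k + 1) =
        (k + 1 + j).choose k + (k + 1 + j).choose (k + 1) := Nat.choose_succ_succ _ _
    omega

/-- In a large set there are `J` distinct `k`-subsets, one of which contains `x`, and one of which
contains `y` if `2 ≤ J`. -/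
theorem exists_family {V : Type*} [Fintype V] {k J : ℕ} (hk : 1 ≤ k) (hJ : 1 ≤ J)
    (hc : J + k ≤ Fintype.card V) (x y : V) :
    ∃ S : Finset (Finset V), S.card = J ∧ (∀ t ∈ S, t.card = k) ∧ (∃ t ∈ S, x ∈ t) ∧
      (2 ≤ J → ∃ t ∈ S, y ∈ t) := by
  classical
  have key : ∀ z : V, ∃ t : Finset V, z ∈ t ∧ t.card = k := by
    intro z
    obtain ⟨t, hzt, -, ht⟩ := Finset.exists_subsuperset_card_eq (Finset.subset_univ {z})
      (n := k) (by simpa using hk) (by rw [Finset.card_univ]; omega)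
    exact ⟨t, hzt (Finset.mem_singleton_self z), ht⟩
  obtain ⟨s, hxs, hs⟩ := key x
  obtain ⟨t, hyt, ht⟩ := key y
  have hcard : J ≤ ((Finset.univ : Finset V).powersetCard k).card := by
    rw [Finset.card_powersetCard, Finset.card_univ]
    obtain ⟨k', rfl⟩ : ∃ k', k = k' + 1 := ⟨k - 1, by omega⟩
    obtain ⟨j, hj⟩ : ∃ j, Fintype.card V = k' + 1 + j := ⟨Fintype.card V - (k' + 1), by omega⟩
    have := add_one_le_choose j k'
    rw [hj]
    omega
  obtain ⟨S, hbS, hS, hSJ⟩ := Finset.exists_subsuperset_card_eq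
    (s := if 2 ≤ J then {s, t} else {s}) (t := (Finset.univ : Finset V).powersetCard k) (n := J)
    (by
      intro r hr
      rw [Finset.mem_powersetCard]
      refine ⟨Finset.subset_univ _, ?_⟩
      split_ifs at hr
      · rcases Finset.mem_insert.1 hr with rfl | hr
        · exact hs
        · rw [Finset.mem_singleton.1 hr, ht]
      · rw [Finset.mem_singleton.1 hr, hs])
    (by
      split_ifs with h
      · exact Finset.card_le_two.trans h
      · simpa using hJ) hcard
  refine ⟨S, hSJ, fun r hr => (Finset.mem_powersetCard.1 (hS hr)).2, ⟨s, hbS ?_, hxs⟩,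
    fun h => ⟨t, hbS ?_, hyt⟩⟩
  · split_ifs <;> simp
  · simp [h]

variable {ι : Type*} [Fintype ι] {α : ι → ℚ} {ar : ι → ℕ} {E₀ : ι} {p q : ℕ} {V₀ : Type}
  [Fintype V₀] {H₀ : EdgeFamily ι V₀}

/-- A stage in the construction of a rank-lowering extension of `H₀`: an extension of relative
rank `γ / q` with a distinguished last vertex `x`. A set `Z` without `x` has nonnegative rank over
its trace on `V₀`; a set `Z` with `x` has relative rank at least `γ / q`, and strictly more unless
it contains the set `U` of the vertices already tied to `x`. -/
def ChainStage (α : ι → ℚ) (ar : ι → ℕ) (q : ℕ) (H₀ : EdgeFamily ι V₀) (γ : ℤ)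
    (U : Finset V₀) : Prop :=
  ∃ (V : Type) (_ : Fintype V) (H : EdgeFamily ι V) (h : V₀ ↪ V) (x : V),
    Uniform ar H ∧ IsEmb H₀ H h ∧
    rank α H Finset.univ = rank α H₀ Finset.univ + γ / q ∧
    ∀ Z : Finset V, (x ∉ Z → rank α H₀ (pull h Z) ≤ rank α H Z) ∧
      (x ∈ Z → rank α H₀ (pull h Z) + γ / q ≤ rank α H Z) ∧
      (x ∈ Z → ¬ U ⊆ pull h Z → rank α H₀ (pull h Z) + γ / q + 1 / q ≤ rank α H Z)

theorem chainStage_zero (h₀ : Uniform ar H₀) (x : V₀) : ChainStage α ar q H₀ 0 ∅ := by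
  have hp : ∀ Z : Finset V₀, pull (Function.Embedding.refl V₀) Z = Z := fun Z => by ext; simp
  refine ⟨V₀, inferInstance, H₀, Function.Embedding.refl _, x, h₀, ?_, ?_, ?_⟩
  · intro E s
    rw [Finset.map_refl]
  · simp
  · intro Z
    simp [hp]

/-- One more vertex `y`, joined by `J` hyperedges with label `E₀` to earlier vertices, one of
which is the last one. A set containing `y` but not all these hyperedges keeps at least one
`α E₀ = p / q`, which exceeds the current relative rank `γ / q < p / q`. -/
theorem ChainStage.step {γ γ' : ℤ} {U U' : Finset V₀} [DecidableEq V₀]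
    (hst : ChainStage α ar q H₀ γ U) (hq : 0 < q) (hα : α E₀ = p / q) (hr : 2 ≤ ar E₀) {J : ℕ}
    (h0 : 0 ≤ γ) (hγp : γ < p) (hγ' : γ' = γ + q - J * p) (hJ : 1 ≤ J)
    (hc : J + ar E₀ ≤ Fintype.card V₀) (y : V₀) (hU : U' = U ∨ 2 ≤ J ∧ U' = insert y U) :
    ChainStage α ar q H₀ γ' U' := by
  classical
  obtain ⟨V, _, H, h, x, hH, hh, htot, hZ⟩ := hst
  have hcV : Fintype.card V₀ ≤ Fintype.card V := Fintype.card_le_of_embedding h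
  obtain ⟨S, hSJ, hSr, ⟨s, hsS, hxs⟩, hSy⟩ :=
    exists_family (V := V) (k := ar E₀ - 1) (by omega) hJ (by omega) x (h y)
  have hq' : (0 : ℚ) < q := by exact_mod_cast hq
  have hγq : (0 : ℚ) ≤ γ / q := div_nonneg (by exact_mod_cast h0) hq'.le
  have hstep : (γ' : ℚ) / q = γ / q + 1 - α E₀ * J := by
    rw [hγ', hα]
    push_cast
    field_simp
  have hgap : (γ : ℚ) / q + 1 / q ≤ α E₀ := by
    rw [hα, ← add_div]
    exact div_le_div_of_nonneg_right (by exact_mod_cast hγp) hq'.le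
  have hα0 : 0 ≤ α E₀ := by rw [hα]; positivity
  have h1q : (0 : ℚ) ≤ 1 / q := by positivity
  refine ⟨Option V, inferInstance, addVertex H E₀ S, h.trans Function.Embedding.some, none,
    hH.addVertex fun t ht => by rw [hSr t ht]; omega, ?_, ?_, ?_⟩
  · intro E t
    rw [← Finset.map_map, isEmb_addVertex, hh]
  · have he : Finset.eraseNone (Finset.univ : Finset (Option V)) = Finset.univ := by
      ext v
      simp
    rw [rank_addVertex, he, htot, hstep]
    simp only [Finset.mem_univ, if_true, Finset.subset_univ, Finset.filter_true, hSJ]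
    ring
  · intro Z
    set W := Finset.eraseNone Z with hW
    have hpull : pull (h.trans Function.Embedding.some) Z = pull h W := by
      ext v
      simp [hW]
    obtain ⟨hW1, hW2, hW3⟩ := hZ W
    have hW0 : rank α H₀ (pull h W) ≤ rank α H W := by
      by_cases hx : x ∈ W
      · linarith [hW2 hx]
      · exact hW1 hx
    rw [hpull, rank_addVertex, ← hW]
    refine ⟨fun hn => by simpa [hn] using hW0, ?_⟩
    by_cases hn : none ∈ Z
    swap
    · exact ⟨fun h => absurd h hn, fun h => absurd h hn⟩
    simp only [hn, if_true, true_imp_iff]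
    have hle : (S.filter (· ⊆ W)).card ≤ J := hSJ ▸ Finset.card_filter_le _ _
    rcases hle.eq_or_lt with heq | hlt
    · have hall : ∀ t ∈ S, t ⊆ W := by
        rw [← hSJ] at heq
        exact Finset.filter_card_eq heq
      have hx : x ∈ W := hall s hsS hxs
      rw [heq]
      refine ⟨by linarith [hW2 hx], fun hU' => ?_⟩
      have : ¬ U ⊆ pull h W := by
        rcases hU with rfl | ⟨h2, rfl⟩
        · exact hU'
        · obtain ⟨t, ht, hyt⟩ := hSy h2
          intro hUW
          exact hU' (Finset.insert_subset (mem_pull.2 (hall t ht hyt)) hUW)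
      linarith [hW3 hx this]
    · have hle' : ((S.filter (· ⊆ W)).card : ℚ) ≤ J - 1 := by
        rw [le_sub_iff_add_le]
        exact_mod_cast hlt
      have hmul := mul_le_mul_of_nonneg_left hle' hα0
      constructor
      · linarith
      · intro _
        linarith

/-- If every label-`E₀` hyperedge has weight `p / q` in lowest terms, then from a large `H₀` the
rank can be lowered by exactly `1 / q`, so that no set has smaller rank than both its trace on `H₀`
and the whole extension. -/
theorem exists_extension_rank_sub [DecidableEq V₀] (h₀ : Uniform ar H₀) (hp : 0 < p) (hpq : p < q)
    (hcop : Nat.Coprime p q) (hα : α E₀ = p / q) (hr : 2 ≤ ar E₀)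
    (hc : q + 1 + ar E₀ ≤ Fintype.card V₀) :
    ∃ (V : Type) (_ : Fintype V) (H : EdgeFamily ι V) (h : V₀ ↪ V),
      Uniform ar H ∧ IsEmb H₀ H h ∧
      rank α H Finset.univ = rank α H₀ Finset.univ - 1 / q ∧
      ∀ Z : Finset V, min (rank α H₀ (pull h Z)) (rank α H₀ Finset.univ - 1 / q) ≤ rank α H Z := by
  have hq : 0 < q := hp.trans hpq
  obtain ⟨x⟩ : Nonempty V₀ := Fintype.card_pos_iff.1 (by omega)
  have bound : ∀ {γ J : ℕ}, γ < p → J * p ≤ γ + q + 1 → J ≤ q + 1 := by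
    intro γ J hγ hJ
    by_contra hlt
    have h1 : (q + 2) * p ≤ J * p := Nat.mul_le_mul_right p (by omega)
    have h2 : q * 1 ≤ q * p := Nat.mul_le_mul_left q hp
    have h3 : (q + 2) * p = q * p + 2 * p := by ring
    omega
  -- All residues modulo `p` are reachable, since `q` is invertible modulo `p`.
  have iter : ∀ (N γ : ℕ) (U : Finset V₀), γ < p → ChainStage α ar q H₀ γ U →
      ChainStage α ar q H₀ ((γ + N * q) % p : ℕ) U := by
    intro N
    induction N with
    | zero =>
      intro γ U hγ hst
      simpa [Nat.mod_eq_of_lt hγ] using hst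
    | succ N ih =>
      intro γ U hγ hst
      have hJ : (γ + q) / p * p + (γ + q) % p = γ + q := Nat.div_add_mod' _ _
      have h1 : ChainStage α ar q H₀ ((γ + q) % p : ℕ) U := by
        refine hst.step (J := (γ + q) / p) hq hα hr (by omega) (by exact_mod_cast hγ) ?_ ?_ ?_ x
          (Or.inl rfl)
        · have : (((γ + q) / p : ℕ) : ℤ) * p + ((γ + q) % p : ℕ) = γ + q := by exact_mod_cast hJ
          linarith
        · rw [Nat.le_div_iff_mul_le hp]
          omega
        · have := bound (J := (γ + q) / p) hγ (by omega)
          omega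
      have h2 := ih _ U (Nat.mod_lt _ hp) h1
      have h3 : ((γ + q) % p + N * q) % p = (γ + (N + 1) * q) % p := by
        rw [Nat.mod_add_mod]
        congr 1
        ring
      rwa [h3] at h2
  have reach : ∀ (γ ρ : ℕ) (U : Finset V₀), γ < p → ρ < p → ChainStage α ar q H₀ γ U →
      ChainStage α ar q H₀ ρ U := by
    intro γ ρ U hγ hρ hst
    have : NeZero p := ⟨hp.ne'⟩
    let N : ℕ := (((ρ : ZMod p) - γ) * (q : ZMod p)⁻¹).val
    have hN : (((γ + N * q : ℕ)) : ZMod p) = (ρ : ℕ) := by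
      have hinv : (q : ZMod p) * (q : ZMod p)⁻¹ = 1 :=
        ZMod.coe_mul_inv_eq_one q hcop.symm
      push_cast
      rw [ZMod.natCast_zmod_val]
      linear_combination ((ρ : ZMod p) - γ) * hinv
    have h1 := (ZMod.natCast_eq_natCast_iff' _ _ _).1 hN
    have h2 := iter N γ U hγ hst
    rwa [h1, Nat.mod_eq_of_lt hρ] at h2
  have cover : ∀ U : Finset V₀, ∃ γ : ℕ, γ < p ∧ ChainStage α ar q H₀ γ U := by
    intro U
    induction U using Finset.induction_on with
    | empty => exact ⟨0, hp, by simpa using chainStage_zero h₀ x⟩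
    | insert y U _ ih =>
      obtain ⟨γ, hγ, hst⟩ := ih
      -- At relative rank `(p - 1) / q` the next vertex receives at least two hyperedges.
      have h1 := reach γ (p - 1) U hγ (by omega) hst
      have hJ : (p - 1 + q) / p * p + (p - 1 + q) % p = p - 1 + q := Nat.div_add_mod' _ _
      have hJ2 : 2 ≤ (p - 1 + q) / p := by
        rw [Nat.le_div_iff_mul_le hp]
        omega
      refine ⟨(p - 1 + q) % p, Nat.mod_lt _ hp, h1.step (J := (p - 1 + q) / p) hq hα hr (by omega)
        (by omega) ?_ (by omega) ?_ y (Or.inr ⟨hJ2, rfl⟩)⟩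
      · have : (((p - 1 + q) / p : ℕ) : ℤ) * p + ((p - 1 + q) % p : ℕ) = ((p - 1 : ℕ) : ℤ) + q := by
          exact_mod_cast hJ
        linarith
      · have := bound (γ := p - 1) (J := (p - 1 + q) / p) (by omega) (by omega)
        omega
  obtain ⟨γ, hγ, hst⟩ := cover Finset.univ
  -- The residue from which one step leads to relative rank `-1 / q`.
  obtain ⟨ρ, J, hρ, hJ⟩ : ∃ ρ J : ℕ, ρ < p ∧ ρ + q + 1 = J * p := by
    refine ⟨p - 1 - q % p, q / p + 1, by omega, ?_⟩
    have h1 := Nat.mod_lt q hp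
    have h2 := Nat.div_add_mod' q p
    rw [add_mul, one_mul]
    omega
  have hJ1 : 1 ≤ J := by
    rcases Nat.eq_zero_or_pos J with rfl | h
    · omega
    · exact h
  have hfin : ChainStage α ar q H₀ (-1) Finset.univ := by
    refine (reach γ ρ _ hγ hρ hst).step (J := J) hq hα hr (by omega) (by exact_mod_cast hρ) ?_ hJ1
      ?_ x (Or.inl rfl)
    · have : (ρ : ℤ) + q + 1 = J * p := by exact_mod_cast hJ
      linarith
    · have := bound hρ hJ.ge
      omega
  obtain ⟨V, hV, H, h, x, hH, hh, htot, hZ⟩ := hfin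
  refine ⟨V, hV, H, h, hH, hh, ?_, fun Z => ?_⟩
  · rw [htot]
    push_cast
    ring
  · obtain ⟨h1, h2, h3⟩ := hZ Z
    have he : ((-1 : ℤ) : ℚ) / q = - (1 / q) := by push_cast; ring
    rw [he] at h2 h3
    by_cases hx : x ∈ Z
    · by_cases hU : Finset.univ ⊆ pull h Z
      · rw [Finset.univ_subset_iff.1 hU] at h2 ⊢
        exact (min_le_right _ _).trans (by linarith [h2 hx])
      · exact (min_le_left _ _).trans (by linarith [h3 hx hU])
    · exact (min_le_left _ _).trans (h1 hx)

end EdgeFamily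

end

section

open EdgeFamily

variable {L : FirstOrder.Language.{u, v}}

/-! ### Structures and hypergraphs -/

/-- The hyperedges of a structure: the sets enumerated by the tuples in its relations. -/
def edges (M : Type*) [L.Structure M] : EdgeFamily (Σ n, L.Relations n) M :=
  fun E => {s | ∃ x : Fin E.1 → M, Language.Structure.RelMap E.2 x ∧ (s : Set M) = Set.range x}

/-- The structure with given hyperedges, each relation holding of all enumerations without
repetition of its hyperedges. -/
abbrev ofHypergraph [L.IsRelational] {V : Type*} (H : EdgeFamily (Σ n, L.Relations n) V) :
    L.Structure V where
  funMap f := isEmptyElim f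
  RelMap {n} E x := Function.Injective x ∧ ∃ s ∈ H ⟨n, E⟩, (s : Set V) = Set.range x

theorem exists_perm_of_range_eq {n : ℕ} {M : Type*} {x y : Fin n → M} (hx : Function.Injective x)
    (hy : Function.Injective y) (h : Set.range x = Set.range y) :
    ∃ σ : Equiv.Perm (Fin n), y ∘ σ = x := by
  refine ⟨(Equiv.ofInjective x hx).trans ((Equiv.setCongr h).trans (Equiv.ofInjective y hy).symm),
    ?_⟩
  funext i
  simp [Equiv.apply_ofInjective_symm]

section Translation

variable {M N : Type*} [L.Structure M] [L.Structure N]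

theorem relMap_iff (hM : IsHypergraph L M) {n : ℕ} (E : L.Relations n) (x : Fin n → M) :
    Language.Structure.RelMap E x ↔
      Function.Injective x ∧ ∃ s ∈ edges M ⟨n, E⟩, (s : Set M) = Set.range x := by
  classical
  constructor
  · intro h
    exact ⟨(hM n E x h).1, Finset.univ.image x, ⟨x, h, by simp⟩, by simp⟩
  · rintro ⟨hx, s, ⟨y, hy, hsy⟩, hsx⟩
    obtain ⟨σ, rfl⟩ := exists_perm_of_range_eq hx (hM n E y hy).1 (hsx.symm.trans hsy)
    exact (hM n E y hy).2 σ

theorem uniform_edges (hM : IsHypergraph L M) : Uniform (fun E => E.1) (edges (L := L) M) := by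
  classical
  rintro ⟨n, E⟩ s ⟨x, hx, hs⟩
  have : s = Finset.univ.image x := by
    apply Finset.coe_injective
    rw [hs]
    simp
  rw [this, Finset.card_image_of_injective _ (hM n E x hx).1]
  simp

theorem isEmb_edges (f : M ↪[L] N) : IsEmb (edges (L := L) M) (edges N) f.toEmbedding := by
  rintro ⟨n, E⟩ s
  constructor
  · rintro ⟨y, hy, hs⟩
    have hmem : ∀ i, ∃ a ∈ s, f a = y i := by
      intro i
      have : y i ∈ ((s.map f.toEmbedding : Finset N) : Set N) := hs ▸ Set.mem_range_self i
      exact Finset.mem_map.1 this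
    choose x hxs hx using hmem
    have hyx : y = f ∘ x := funext fun i => (hx i).symm
    subst hyx
    refine ⟨x, (f.map_rel E x).1 hy, ?_⟩
    rw [Set.range_comp, Finset.coe_map] at hs
    exact f.injective.image_injective hs
  · rintro ⟨x, hx, hs⟩
    refine ⟨f ∘ x, (f.map_rel E x).2 hx, ?_⟩
    rw [Set.range_comp, Finset.coe_map, hs]
    rfl

theorem IsHypergraph.of_emb (hN : IsHypergraph L N) (f : M ↪[L] N) : IsHypergraph L M := by
  intro n E x hx
  have h := hN n E (f ∘ x) ((f.map_rel E x).2 hx)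
  refine ⟨h.1.of_comp, fun σ => (f.map_rel E (x ∘ σ)).1 ?_⟩
  exact h.2 σ

/-- A map of hypergraphs that embeds the hyperedges is an embedding of structures. -/
def embOfIsEmb [L.IsRelational] (hM : IsHypergraph L M) (hN : IsHypergraph L N) (f : M ↪ N)
    (hf : IsEmb (edges (L := L) M) (edges N) f) : M ↪[L] N where
  toEmbedding := f
  map_fun' g := isEmptyElim g
  map_rel' {n} E x := by
    change Language.Structure.RelMap E (f ∘ x) ↔ Language.Structure.RelMap E x
    rw [relMap_iff hN, relMap_iff hM, f.injective.of_comp_iff]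
    refine and_congr_right fun _ => ?_
    constructor
    · rintro ⟨t, ht, htx⟩
      obtain ⟨s, rfl⟩ : ∃ s : Finset M, s.map f = t := by
        classical
        refine ⟨Finset.univ.image x, Finset.coe_injective ?_⟩
        rw [htx, Set.range_comp]
        simp
      refine ⟨s, (hf _ s).1 ht, f.injective.image_injective ?_⟩
      rw [← Finset.coe_map, htx, Set.range_comp]
    · rintro ⟨s, hs, hsx⟩
      refine ⟨s.map f, (hf _ s).2 hs, ?_⟩
      rw [Set.range_comp, ← hsx, Finset.coe_map]

theorem edges_ofHypergraph [L.IsRelational] {V : Type*} {H : EdgeFamily (Σ n, L.Relations n) V}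
    (hH : Uniform (fun E => E.1) H) :
    @edges L V (ofHypergraph H) = H := by
  funext ⟨n, E⟩
  ext s
  constructor
  · rintro ⟨x, ⟨-, t, ht, htx⟩, hs⟩
    rwa [Finset.coe_injective (hs.trans htx.symm)]
  · intro hs
    have hcard : s.card = n := hH ⟨n, E⟩ s hs
    let e := (s.equivFinOfCardEq hcard).symm
    have hr : (s : Set V) = Set.range fun i => (e i : V) := by
      ext v
      simp only [Finset.mem_coe, Set.mem_range]
      constructor
      · intro hv
        exact ⟨e.symm ⟨v, hv⟩, by simp⟩
      · rintro ⟨i, rfl⟩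
        exact (e i).2
    exact ⟨fun i => e i, ⟨Subtype.val_injective.comp e.injective, s, hs, hr⟩, hr⟩

theorem isHypergraph_ofHypergraph [L.IsRelational] {V : Type*}
    (H : EdgeFamily (Σ n, L.Relations n) V) : @IsHypergraph L V (ofHypergraph H) := by
  rintro n E x ⟨hx, s, hs, hsx⟩
  refine ⟨hx, fun σ => ⟨hx.comp σ.injective, s, hs, ?_⟩⟩
  rw [hsx, Set.range_comp, σ.range_eq_univ, Set.image_univ]

end Translation

section Rank

variable [Fintype (Σ n, L.Relations n)] {α : (Σ n, L.Relations n) → ℚ}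
variable {M N : Type*} [L.Structure M] [L.Structure N]

theorem delta_eq_rank (X : Finset M) : delta α X = rank α (edges (L := L) M) X := by
  classical
  have : ∀ E : (Σ n, L.Relations n), numEdges E X = count (edges (L := L) M) E X := by
    intro E
    unfold numEdges count
    rw [← Set.ncard_coe_finset, ← Set.ncard_image_of_injective _ Finset.coe_injective]
    congr 1
    ext s
    simp only [Set.mem_ofPred_eq, Set.mem_image, Finset.coe_filter, Finset.mem_powerset]
    constructor
    · rintro ⟨hs, x, hx, rfl⟩
      refine ⟨Finset.univ.image x, ⟨?_, x, hx, by simp⟩, by simp⟩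
      rw [← Finset.coe_subset]
      simpa using hs
    · rintro ⟨t, ⟨ht, x, hx, htx⟩, rfl⟩
      exact ⟨by exact_mod_cast ht, x, hx, htx.symm⟩
  simp only [delta, rank, this]

theorem delta_map (f : M ↪[L] N) (X : Finset M) :
    delta α (X.map f.toEmbedding) = delta α X := by
  rw [delta_eq_rank, delta_eq_rank, rank_map α (isEmb_edges f)]

theorem InKBar.of_emb (hN : InKBar α N) (f : M ↪[L] N) : InKBar α M :=
  ⟨hN.1.of_emb f, fun X => delta_map (α := α) f X ▸ hN.2 _⟩

theorem delta_empty (har : ∀ E : (Σ n, L.Relations n), 2 ≤ E.1) (hM : IsHypergraph L M) :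
    delta α (∅ : Finset M) = 0 := by
  rw [delta_eq_rank, rank_empty α har (uniform_edges hM)]

theorem delta_submodular [DecidableEq M] (hα : ∀ E, 0 ≤ α E) (X Y : Finset M) :
    delta α (X ∪ Y) + delta α (X ∩ Y) ≤ delta α X + delta α Y := by
  simp only [delta_eq_rank]
  exact rank_submodular hα _ X Y

theorem strongIn_iff {X : Finset M} :
    StrongIn α X ↔ ∀ Y : Finset M, X ⊆ Y → delta α X ≤ delta α Y :=
  ⟨fun h Y hY => (h Y hY).2 Y hY subset_rfl, fun h _ hY => ⟨hY, fun Z hZ _ => h Z hZ⟩⟩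

theorem StrongIn.delta_inter_le [DecidableEq M] (hα : ∀ E, 0 ≤ α E) {X : Finset M}
    (hX : StrongIn α X) (Z : Finset M) : delta α (Z ∩ X) ≤ delta α Z := by
  have h1 := delta_submodular hα Z X
  have h2 := strongIn_iff.1 hX (Z ∪ X) Finset.subset_union_right
  linarith

/-- The finite set of all elements of a finite structure. -/
noncomputable def whole (A : Type*) [Finite A] : Finset A := (Set.finite_univ (α := A)).toFinset

@[simp] theorem mem_whole {A : Type*} [Finite A] (a : A) : a ∈ whole A := by simp [whole]

theorem whole_eq_univ (A : Type*) [Fintype A] : whole A = Finset.univ := by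
  ext
  simp

theorem eq_whole {A : Type*} [Finite A] {X : Finset A} (h : ∀ a, a ∈ X) : X = whole A := by
  ext a
  simp [h]

theorem isStrongEmb_iff {A : Type*} [L.Structure A] [Finite A] {f : A ↪[L] M} :
    IsStrongEmb α f ↔ StrongIn α ((whole A).map f.toEmbedding) := by
  have key : ∀ X : Finset M, (X : Set M) = Set.range f → X = (whole A).map f.toEmbedding := by
    intro X hX
    apply Finset.coe_injective
    rw [hX, Finset.coe_map]
    ext x
    simp only [Set.mem_range, Set.mem_image, Finset.mem_coe, mem_whole, true_and]
    rfl
  constructor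
  · rintro ⟨X, hX, hs⟩
    rwa [← key X hX]
  · intro h
    refine ⟨_, ?_, h⟩
    rw [Finset.coe_map]
    ext x
    simp only [Set.mem_range, Set.mem_image, Finset.mem_coe, mem_whole, true_and]
    rfl

theorem IsStrongEmb.finite {f : N ↪[L] M} (hf : IsStrongEmb α f) : Finite N := by
  obtain ⟨X, hX, -⟩ := hf
  have : (Set.range f).Finite := hX ▸ X.finite_toSet
  exact Set.finite_range_iff f.injective |>.1 this

theorem map_pull_eq_inter [DecidableEq M] {A : Type*} [Finite A] (f : A ↪ M) (Z : Finset M) :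
    (pull f Z).map f = Z ∩ (whole A).map f := by
  ext x
  simp only [Finset.mem_map, mem_pull, Finset.mem_inter, mem_whole, true_and]
  constructor
  · rintro ⟨a, ha, rfl⟩
    exact ⟨ha, a, rfl⟩
  · rintro ⟨hx, a, rfl⟩
    exact ⟨a, hx, rfl⟩

theorem IsStrongEmb.delta_pull_le (hα : ∀ E, 0 ≤ α E) {f : N ↪[L] M} (hf : IsStrongEmb α f)
    (Z : Finset M) : delta α (pull f.toEmbedding Z) ≤ delta α Z := by
  classical
  have := hf.finite
  rw [← delta_map f, map_pull_eq_inter]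
  exact (isStrongEmb_iff.1 hf).delta_inter_le hα Z

theorem isStrongEmb_of_delta_pull_le [Finite N] {f : N ↪[L] M}
    (h : ∀ Z : Finset M, delta α (pull f.toEmbedding Z) ≤ delta α Z) : IsStrongEmb α f := by
  rw [isStrongEmb_iff, strongIn_iff]
  intro Y hY
  rw [← subset_pull] at hY
  have : pull f.toEmbedding Y = whole N := eq_whole fun a => hY (mem_whole a)
  rw [delta_map, ← this]
  exact h Y

theorem StrongIn.map (hα : ∀ E, 0 ≤ α E) {X : Finset N} (hX : StrongIn α X) {f : N ↪[L] M}
    (hf : IsStrongEmb α f) : StrongIn α (X.map f.toEmbedding) := by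
  rw [strongIn_iff] at hX ⊢
  intro Y hY
  rw [delta_map]
  exact (hX _ (subset_pull.2 hY)).trans (hf.delta_pull_le hα Y)

theorem IsStrongEmb.comp (hα : ∀ E, 0 ≤ α E) {A : Type*} [L.Structure A] {g : N ↪[L] M}
    {f : A ↪[L] N} (hg : IsStrongEmb α g) (hf : IsStrongEmb α f) : IsStrongEmb α (g.comp f) := by
  have := hf.finite
  rw [isStrongEmb_iff] at hf ⊢
  have h := hf.map hα hg
  rwa [Finset.map_map] at h

end Rank

end

section

open EdgeFamily

/-! ### Amalgamation in `K_α` -/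

theorem exists_coprime_eq_div {a : ℚ} (h0 : 0 < a) (h1 : a < 1) :
    ∃ p q : ℕ, 0 < p ∧ p < q ∧ Nat.Coprime p q ∧ a = p / q := by
  have h0' : 0 < a.num := Rat.num_pos.2 h0
  obtain ⟨p, hp⟩ := Int.eq_ofNat_of_zero_le h0'.le
  have heq : a = (p : ℚ) / (a.den : ℚ) := by
    conv_lhs => rw [← Rat.num_div_den a, hp]
    simp
  refine ⟨p, a.den, by omega, ?_, ?_, heq⟩
  · rw [heq, div_lt_one (by exact_mod_cast a.den_pos)] at h1
    exact_mod_cast h1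
  · have := a.reduced
    rwa [hp] at this

variable {L : FirstOrder.Language.{u, v}} [L.IsRelational]
variable [Fintype (Σ n, L.Relations n)] {α : (Σ n, L.Relations n) → ℚ}

/-- The free amalgam of `B` and `C` over `A`, for `A ≤ B`. -/
theorem exists_freeAmalgam (hα : ∀ E, 0 ≤ α E) {A B C : Type} [L.Structure A] [L.Structure B]
    [L.Structure C] [Finite B] [Finite C] (hB : InKBar α B) (hC : InKBar α C) {e : A ↪[L] B}
    (he : IsStrongEmb α e) (f : A ↪[L] C) [Finite A] :
    ∃ (D : Bundled.{0} L.Structure) (_ : Finite D) (i : B ↪[L] D) (j : C ↪[L] D),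
      InKBar α D ∧ i.comp e = j.comp f ∧ IsStrongEmb α j ∧ (IsStrongEmb α f → IsStrongEmb α i) ∧
      delta α (whole D) + delta α (whole A) = delta α (whole B) + delta α (whole C) := by
  obtain ⟨V, _, i, j, hsq⟩ := exists_isFreeSquare e.toEmbedding f.toEmbedding
  set H := glue i j (edges (L := L) B) (edges C) with hH
  let _ : L.Structure V := ofHypergraph H
  have hHV : IsHypergraph L V := isHypergraph_ofHypergraph H
  have hedges : edges (L := L) V = H :=
    edges_ofHypergraph ((uniform_edges hB.1).glue (uniform_edges hC.1) i j)
  have hi : IsEmb (edges (L := L) B) (edges V) i := by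
    rw [hedges]
    exact hsq.isEmb_left (isEmb_edges e) (isEmb_edges f)
  have hj : IsEmb (edges (L := L) C) (edges V) j := by
    rw [hedges]
    exact hsq.isEmb_right (isEmb_edges e) (isEmb_edges f)
  have hadd : ∀ Z : Finset V, delta α Z + delta α (pull (e.toEmbedding.trans i) Z) =
      delta α (pull i Z) + delta α (pull j Z) := by
    intro Z
    simp only [delta_eq_rank, hedges]
    exact hsq.rank_add α (isEmb_edges e) (isEmb_edges f) Z
  have hcomm : e.toEmbedding.trans i = f.toEmbedding.trans j := by
    ext a
    exact hsq.comm a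
  have hj' : ∀ Z : Finset V, delta α (pull j Z) ≤ delta α Z := by
    intro Z
    have h1 := hadd Z
    have h2 := he.delta_pull_le hα (pull i Z)
    rw [pull_trans] at h1
    linarith
  have hpull : ∀ {W : Type} [Finite W] (g : W ↪ V), pull g (whole V) = whole W :=
    fun g => eq_whole fun a => by simp
  refine ⟨⟨V, inferInstance⟩, inferInstance, embOfIsEmb hB.1 hHV i hi,
    embOfIsEmb hC.1 hHV j hj, ⟨hHV, fun X => (hC.2 _).trans (hj' X)⟩, ?_,
    isStrongEmb_of_delta_pull_le hj', fun hf => isStrongEmb_of_delta_pull_le fun Z => ?_, ?_⟩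
  · ext a
    exact hsq.comm a
  · have h1 := hadd Z
    have h2 := hf.delta_pull_le hα (pull j Z)
    rw [hcomm, pull_trans] at h1
    change delta α (pull i Z) ≤ _
    linarith
  · have h1 := hadd (whole V)
    rw [hpull, hpull, hpull] at h1
    exact h1

/-! ### Lowering the rank -/

/-- The structure on a finite set without hyperedges. -/
theorem exists_free_points (n : ℕ) :
    ∃ (D : Bundled.{0} L.Structure) (_ : Finite D), InKBar α D ∧ Nat.card D = n ∧
      delta α (whole D) = n := by
  let _ : L.Structure (Fin n) := ofHypergraph fun _ => ∅
  have hH : IsHypergraph L (Fin n) := isHypergraph_ofHypergraph _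
  have hedges : edges (L := L) (Fin n) = fun _ => ∅ :=
    edges_ofHypergraph fun _ _ h => (Set.notMem_empty _ h).elim
  have hd : ∀ X : Finset (Fin n), delta α X = X.card := by
    intro X
    rw [delta_eq_rank, hedges]
    simp [rank, count]
  refine ⟨⟨Fin n, inferInstance⟩, inferInstance, ⟨hH, fun X => ?_⟩, by simp, ?_⟩
  · rw [hd]
    positivity
  · rw [hd, whole_eq_univ]
    simp

theorem exists_strongEmb_of_isEmpty (har : ∀ E : (Σ n, L.Relations n), 2 ≤ E.1) {A M : Type*}
    [L.Structure A] [IsEmpty A] (hA : IsHypergraph L A) [L.Structure M] (hM : InKBar α M) :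
    ∃ e : A ↪[L] M, IsStrongEmb α e := by
  refine ⟨embOfIsEmb hA hM.1 ⟨fun a => isEmptyElim a, fun a => isEmptyElim a⟩ ?_,
    isStrongEmb_of_delta_pull_le fun Z => ?_⟩
  · intro E s
    have hs : s = ∅ := Finset.eq_empty_of_isEmpty s
    have h2 := har E
    subst hs
    constructor
    · intro h
      have := uniform_edges hM.1 E _ h
      simp at this
      omega
    · intro h
      have := uniform_edges hA E _ h
      simp at this
      omega
  · rw [Finset.eq_empty_of_isEmpty (pull _ Z), delta_empty har hA]
    exact hM.2 Z

/-- Disjoint unions. -/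
theorem exists_sum (har : ∀ E : (Σ n, L.Relations n), 2 ≤ E.1) (hα : ∀ E, 0 ≤ α E) {B C : Type}
    [L.Structure B] [L.Structure C] [Finite B] [Finite C] (hB : InKBar α B) (hC : InKBar α C) :
    ∃ (D : Bundled.{0} L.Structure) (_ : Finite D) (i : B ↪[L] D) (j : C ↪[L] D),
      InKBar α D ∧ IsStrongEmb α i ∧ IsStrongEmb α j ∧
      delta α (whole D) = delta α (whole B) + delta α (whole C) := by
  obtain ⟨A, _, hA, hcard, hd⟩ := exists_free_points (α := α) 0
  have : IsEmpty A := (Finite.card_eq_zero_iff).1 hcard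
  obtain ⟨e, he⟩ := exists_strongEmb_of_isEmpty har hA.1 hB
  obtain ⟨f, hf⟩ := exists_strongEmb_of_isEmpty har hA.1 hC
  obtain ⟨D, hD, i, j, hDK, -, hj, hi, hadd⟩ := exists_freeAmalgam hα hB hC he f
  refine ⟨D, hD, i, j, hDK, hi hf, hj, ?_⟩
  rw [← hadd, hd]
  simp

theorem exists_copies (har : ∀ E : (Σ n, L.Relations n), 2 ≤ E.1) (hα : ∀ E, 0 ≤ α E) {B : Type}
    [L.Structure B] [Finite B] (hB : InKBar α B) (n : ℕ) :
    ∃ (D : Bundled.{0} L.Structure) (_ : Finite D), InKBar α D ∧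
      delta α (whole D) = n * delta α (whole B) := by
  induction n with
  | zero =>
    obtain ⟨D, hD, hDK, -, hd⟩ := exists_free_points (α := α) 0
    exact ⟨D, hD, hDK, by rw [hd]; simp⟩
  | succ n ih =>
    obtain ⟨D, hD, hDK, hd⟩ := ih
    obtain ⟨D', hD', -, -, hDK', -, -, hd'⟩ := exists_sum har hα hDK hB
    exact ⟨D', hD', hDK', by rw [hd', hd]; push_cast; ring⟩

/-- Repeated lowering of the rank of a large structure by `1 / q`. -/
theorem exists_lower_of_card (har : ∀ E : (Σ n, L.Relations n), 2 ≤ E.1)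
    {E₀ : Σ n, L.Relations n} {p q : ℕ} (hp : 0 < p) (hpq : p < q) (hcop : Nat.Coprime p q)
    (hα₀ : α E₀ = p / q) {m : ℚ} (hm : 0 ≤ m) (l : ℕ) :
    ∀ {F : Type} [L.Structure F] [Finite F], InKBar α F → q + 1 + E₀.1 ≤ Nat.card F →
      delta α (whole F) = m + l / q →
      ∃ (D : Bundled.{0} L.Structure) (_ : Finite D) (h : F ↪[L] D), InKBar α D ∧
        delta α (whole D) = m ∧
        ∀ Z : Finset D, min (delta α (pull h.toEmbedding Z)) m ≤ delta α Z := by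
  induction l with
  | zero =>
    intro F _ _ hF _ hd
    refine ⟨⟨F, inferInstance⟩, inferInstance, Language.Embedding.refl L F, hF, by simpa using hd,
      fun Z => (min_le_left _ _).trans (le_of_eq ?_)⟩
    congr 1
    ext a
    exact mem_pull
  | succ l ih =>
    intro F _ _ hF hcard hd
    classical
    have := Fintype.ofFinite F
    have hq' : (0 : ℚ) ≤ l / q := by positivity
    have hdl : rank α (edges (L := L) F) Finset.univ - 1 / q = m + l / q := by
      rw [← delta_eq_rank, ← whole_eq_univ, hd]
      push_cast
      ring
    obtain ⟨V, _, H, h, hH, hh, htot, hZ⟩ := exists_extension_rank_sub (α := α)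
      (uniform_edges hF.1) hp hpq hcop hα₀ (har E₀) (by rwa [← Nat.card_eq_fintype_card])
    rw [hdl] at htot hZ
    let _ : L.Structure V := ofHypergraph H
    have hHV : IsHypergraph L V := isHypergraph_ofHypergraph H
    have hedges : edges (L := L) V = H := edges_ofHypergraph hH
    have hmin : ∀ Z : Finset V, min (delta α (pull h Z)) (m + l / q) ≤ delta α Z := by
      intro Z
      rw [delta_eq_rank, delta_eq_rank, hedges]
      exact hZ Z
    have hVK : InKBar α V :=
      ⟨hHV, fun X => (le_min (hF.2 _) (by positivity)).trans (hmin X)⟩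
    obtain ⟨D, hD, k, hDK, hdD, hDmin⟩ := ih hVK
      (hcard.trans (Nat.card_le_card_of_injective h h.injective))
      (by rw [whole_eq_univ, delta_eq_rank, hedges, htot])
    refine ⟨D, hD, k.comp (embOfIsEmb hF.1 hHV h (by rwa [hedges])), hDK, hdD, fun Z => ?_⟩
    have hpull : pull (k.comp (embOfIsEmb hF.1 hHV h (by rwa [hedges]))).toEmbedding Z =
        pull h (pull k.toEmbedding Z) := pull_trans h k.toEmbedding Z
    rw [hpull]
    have h1 := hmin (pull k.toEmbedding Z)
    have h2 : min (delta α (pull h (pull k.toEmbedding Z))) m ≤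
        delta α (pull k.toEmbedding Z) :=
      (min_le_min le_rfl (by linarith)).trans h1
    exact (le_min h2 (min_le_right _ _)).trans (hDmin Z)

/-- Every `F` in `K_α` extends to a structure in `K_α` with the rank of a given `C` in `K_α`, such
that the strong substructures of `F` of rank at most `δ(C)` remain strong. -/
theorem exists_lower (har : ∀ E : (Σ n, L.Relations n), 2 ≤ E.1)
    [Nonempty (Σ n, L.Relations n)] (hα : ∀ E, 0 < α E ∧ α E < 1) {F C : Type} [L.Structure F]
    [L.Structure C] [Finite F] [Finite C] (hF : InKBar α F) (hC : InKBar α C) :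
    ∃ (D : Bundled.{0} L.Structure) (_ : Finite D) (h : F ↪[L] D), InKBar α D ∧
      delta α (whole D) = delta α (whole C) ∧ ∀ X : Finset F, StrongIn α X →
        delta α X ≤ delta α (whole C) → StrongIn α (X.map h.toEmbedding) := by
  have hα0 : ∀ E, 0 ≤ α E := fun E => (hα E).1.le
  obtain ⟨E₀⟩ := ‹Nonempty (Σ n, L.Relations n)›
  obtain ⟨p, q, hp, hpq, hcop, hα₀⟩ := exists_coprime_eq_div (hα E₀).1 (hα E₀).2
  set f := delta α (whole F) with hf
  have hf0 : 0 ≤ f := hF.2 _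
  -- Disjoint copies of `F` make the rank congruent to that of `C` modulo `1`.
  obtain ⟨D₁, _, hD₁, hd₁⟩ := exists_copies har hα0 hF (f.den - 1)
  obtain ⟨D₂, _, hD₂, hcard₂, hd₂⟩ := exists_free_points (α := α) (q + 1 + E₀.1)
  obtain ⟨D₃, _, -, j₃, hD₃, -, -, hd₃⟩ := exists_sum har hα0 hD₁ hD₂
  obtain ⟨D₄, _, -, j₄, hD₄, -, -, hd₄⟩ := exists_sum har hα0 hC hD₃
  obtain ⟨D₅, _, i, j₅, hD₅, hi, -, hd₅⟩ := exists_sum har hα0 hF hD₄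
  have hcard : q + 1 + E₀.1 ≤ Nat.card D₅ := by
    rw [← hcard₂]
    exact Nat.card_le_card_of_injective _ ((j₅.comp j₄).comp j₃).injective
  have hden : ((f.den - 1 : ℕ) : ℚ) = f.den - 1 := by
    rw [Nat.cast_sub f.den_pos, Nat.cast_one]
  obtain ⟨k, hk⟩ := Int.eq_ofNat_of_zero_le (Rat.num_nonneg.2 hf0)
  have hnum : (f.den : ℚ) * f = k := by
    rw [mul_comm, Rat.mul_den_eq_num, hk]
    simp
  have hq : (q : ℚ) ≠ 0 := by exact_mod_cast (hp.trans hpq).ne'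
  obtain ⟨D, hD, h, hDK, hd, hmin⟩ := exists_lower_of_card har hp hpq hcop hα₀ (hC.2 (whole C))
    ((k + (q + 1 + E₀.1)) * q) hD₅ hcard (by
      rw [hd₅, hd₄, hd₃, hd₁, hd₂, hden, Nat.cast_mul, mul_div_cancel_right₀ _ hq, ← hf]
      push_cast
      linarith)
  refine ⟨D, hD, h.comp i, hDK, hd, fun X hX hXC => ?_⟩
  rw [strongIn_iff] at hX ⊢
  intro Y hY
  have h1 : X ⊆ pull i.toEmbedding (pull h.toEmbedding Y) := by
    intro a ha
    exact mem_pull.2 (mem_pull.2 (hY (Finset.mem_map_of_mem _ ha)))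
  rw [delta_map]
  exact (le_min ((hX _ h1).trans (hi.delta_pull_le hα0 _)) hXC).trans (hmin Y)

end

section

open EdgeFamily

variable {L : FirstOrder.Language.{u, v}}

/-! ### Ranks of finite substructures -/

/-- Every finite substructure is the image of a finite structure in the lowest universe. -/
theorem exists_copy [L.IsRelational] {M : Type*} [L.Structure M] (X : Finset M) :
    ∃ (A : Bundled.{0} L.Structure) (_ : Finite A) (f : A ↪[L] M),
      (whole A).map f.toEmbedding = X := by
  let φ : Fin X.card → M := fun i => X.equivFin.symm i
  have hφ : Function.Injective φ := Subtype.val_injective.comp X.equivFin.symm.injective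
  let _ : L.Structure (Fin X.card) :=
    { funMap := fun f => isEmptyElim f
      RelMap := fun E x => Language.Structure.RelMap E (φ ∘ x) }
  refine ⟨⟨Fin X.card, inferInstance⟩, inferInstance,
    ⟨⟨φ, hφ⟩, fun f => isEmptyElim f, fun _ _ => Iff.rfl⟩, ?_⟩
  ext a
  simp only [Finset.mem_map, mem_whole, true_and]
  constructor
  · rintro ⟨i, rfl⟩
    exact (X.equivFin.symm i).2
  · intro ha
    refine ⟨X.equivFin ⟨a, ha⟩, ?_⟩
    change ((X.equivFin.symm (X.equivFin ⟨a, ha⟩) : X) : M) = a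
    simp

variable [Fintype (Σ n, L.Relations n)] {α : (Σ n, L.Relations n) → ℚ}

section Denominators

variable {M : Type*} [L.Structure M]

theorem commonDenom_pos : 0 < commonDenom α := by
  rw [commonDenom, Nat.pos_iff_ne_zero, Ne, Finset.lcm_eq_zero_iff]
  rintro ⟨E, -, hE⟩
  exact (α E).den_ne_zero hE

/-- The rank takes values in `(1/c) ℕ`. -/
theorem InKBar.exists_delta_eq (hM : InKBar α M) (X : Finset M) :
    ∃ k : ℕ, delta α X = (k : ℚ) / (commonDenom α : ℚ) := by
  have hc : (0 : ℚ) < commonDenom α := by exact_mod_cast commonDenom_pos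
  have hint : ∀ E, ∃ z : ℤ, (commonDenom α : ℚ) * α E = z := by
    intro E
    obtain ⟨d, hd⟩ : (α E).den ∣ commonDenom α := Finset.dvd_lcm (Finset.mem_univ E)
    refine ⟨d * (α E).num, ?_⟩
    rw [hd]
    push_cast
    rw [← Rat.mul_den_eq_num (α E)]
    ring
  choose z hz using hint
  have h1 : (commonDenom α : ℚ) * delta α X =
      ((commonDenom α * X.card - ∑ E, z E * numEdges E X : ℤ) : ℚ) := by
    unfold delta
    push_cast
    rw [mul_sub, Finset.mul_sum]
    congr 1
    refine Finset.sum_congr rfl fun E _ => ?_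
    rw [← mul_assoc, hz]
  have h2 : 0 ≤ (commonDenom α : ℚ) * delta α X := mul_nonneg hc.le (hM.2 X)
  rw [h1] at h2
  obtain ⟨k, hk⟩ := Int.eq_ofNat_of_zero_le (Int.cast_nonneg_iff.1 h2)
  rw [hk] at h1
  refine ⟨k, ?_⟩
  rw [eq_div_iff hc.ne', mul_comm, h1]
  simp

/-- A finite superset of least rank is strong. -/
theorem InKBar.exists_strongIn (hM : InKBar α M) (X : Finset M) :
    ∃ Y : Finset M, X ⊆ Y ∧ StrongIn α Y := by
  classical
  have hc : (0 : ℚ) < commonDenom α := by exact_mod_cast commonDenom_pos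
  have hex : ∃ k : ℕ, ∃ Y : Finset M, X ⊆ Y ∧ delta α Y = (k : ℚ) / (commonDenom α : ℚ) := by
    obtain ⟨k, hk⟩ := hM.exists_delta_eq X
    exact ⟨k, X, subset_rfl, hk⟩
  obtain ⟨Y, hXY, hY⟩ := Nat.find_spec hex
  refine ⟨Y, hXY, strongIn_iff.2 fun Z hZ => ?_⟩
  obtain ⟨k, hk⟩ := hM.exists_delta_eq Z
  rw [hY, hk]
  have : Nat.find hex ≤ k := Nat.find_min' hex ⟨Z, hXY.trans hZ, hk⟩
  exact div_le_div_of_nonneg_right (by exact_mod_cast this) hc.le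

end Denominators

/-- A strong embedding factors strongly through any larger finite substructure. -/
theorem exists_factor [L.IsRelational] {M A C : Type*} [L.Structure M] [L.Structure A]
    [L.Structure C] [Finite A] [Finite C] (hα : ∀ E, 0 ≤ α E) {f : A ↪[L] M}
    (hf : IsStrongEmb α f) {c : C ↪[L] M}
    (h : (whole A).map f.toEmbedding ⊆ (whole C).map c.toEmbedding) :
    ∃ f' : A ↪[L] C, c.comp f' = f ∧ IsStrongEmb α f' := by
  have hmem : ∀ a, ∃ x, c x = f a := by
    intro a
    obtain ⟨x, -, hx⟩ := Finset.mem_map.1 (h (Finset.mem_map.2 ⟨a, mem_whole a, rfl⟩))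
    exact ⟨x, hx⟩
  choose f₀ hf₀ using hmem
  refine ⟨⟨⟨f₀, fun a b hab => f.injective (by rw [← hf₀, ← hf₀, hab])⟩,
    fun g => isEmptyElim g, fun E x => ?_⟩, Language.Embedding.ext hf₀,
    isStrongEmb_of_delta_pull_le fun W => ?_⟩
  · rw [← f.map_rel E x, ← c.map_rel E]
    have : (c ∘ f₀ ∘ x) = f ∘ x := funext fun i => hf₀ (x i)
    exact iff_of_eq (congrArg _ this)
  · have h1 := hf.delta_pull_le hα (W.map c.toEmbedding)
    rw [delta_map] at h1
    convert h1 using 2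
    ext a
    rw [mem_pull, mem_pull]
    change f₀ a ∈ W ↔ f a ∈ _
    rw [← hf₀]
    exact (Finset.mem_map' c.toEmbedding).symm

section Models

variable {M : Type w} [L.Structure M]

theorem inKBar_of_models [L.IsRelational] (hM : M ⊨ S α) : InKBar α M := by
  classical
  have h1 := ((models_S_iff α M).1 hM).1
  constructor
  · intro n E x hx
    obtain ⟨A, hA, f, hf⟩ := exists_copy (L := L) (Finset.univ.image x)
    have hAK := h1 A hA ⟨f⟩
    have hmem : ∀ i, ∃ a, f a = x i := by
      intro i
      have : x i ∈ (whole A).map f.toEmbedding := by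
        rw [hf]
        exact Finset.mem_image_of_mem x (Finset.mem_univ i)
      obtain ⟨a, -, ha⟩ := Finset.mem_map.1 this
      exact ⟨a, ha⟩
    choose y hy using hmem
    have hyx : x = f ∘ y := funext fun i => (hy i).symm
    subst hyx
    have h := hAK.2.1 n E y ((f.map_rel E y).1 hx)
    exact ⟨f.injective.comp h.1, fun σ => (f.map_rel E (y ∘ σ)).2 (h.2 σ)⟩
  · intro X
    obtain ⟨A, hA, f, hf⟩ := exists_copy (L := L) X
    rw [← hf, delta_map]
    exact (h1 A hA ⟨f⟩).2.2 _

theorem exists_extension_of_models [L.IsRelational] (hM : M ⊨ S α) {A B : Type}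
    [L.Structure A] [L.Structure B] [Finite B] (hB : InKBar α B) {e : A ↪[L] B}
    (he : IsStrongEmb α e) (f : A ↪[L] M) :
    ∃ g : B ↪[L] M, g.comp e = f :=
  ((models_S_iff α M).1 hM).2 ⟨A, inferInstance⟩ ⟨B, inferInstance⟩ ⟨he.finite, hB.of_emb e⟩
    ⟨inferInstance, hB⟩ e he f

/-- An extension of a strong substructure without increase of rank is strong. -/
theorem isStrongEmb_of_delta_le {A D : Type*} [L.Structure A] [L.Structure D] [Finite A]
    [Finite D] {k : A ↪[L] D} {g : D ↪[L] M} (h : IsStrongEmb α (g.comp k))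
    (hd : delta α (whole D) ≤ delta α (whole A)) : IsStrongEmb α g := by
  rw [isStrongEmb_iff, strongIn_iff] at h ⊢
  intro Y hY
  have h1 := h Y (by
    intro x hx
    obtain ⟨a, -, rfl⟩ := Finset.mem_map.1 hx
    exact hY (Finset.mem_map.2 ⟨k a, mem_whole _, rfl⟩))
  rw [delta_map] at h1 ⊢
  exact hd.trans h1

end Models

/-! ### Dimension -/

section Dimension

variable {M : Type*} [L.Structure M]

theorem dim_set_eq (har : ∀ E : (Σ n, L.Relations n), 2 ≤ E.1) (hM : InKBar α M) :
    {q | ∃ B : Finset M, StrongPair α ∅ B ∧ StrongIn α B ∧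
      q = delta α B - delta α (∅ : Finset M)} =
      {q | ∃ B : Finset M, StrongIn α B ∧ q = delta α B} := by
  have h0 := delta_empty (α := α) har hM.1
  ext q
  constructor
  · rintro ⟨B, -, hB, hq⟩
    exact ⟨B, hB, by rw [hq, h0, sub_zero]⟩
  · rintro ⟨B, hB, hq⟩
    exact ⟨B, ⟨Finset.empty_subset B, fun Z _ _ => h0 ▸ hM.2 Z⟩, hB, by rw [hq, h0, sub_zero]⟩

theorem dim_eq_coe_iff (har : ∀ E : (Σ n, L.Relations n), 2 ≤ E.1) (hM : InKBar α M) (d : ℚ) :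
    dim α M = (d : WithTop ℚ) ↔
      (∃ B : Finset M, StrongIn α B ∧ delta α B = d) ∧
        ∀ B : Finset M, StrongIn α B → delta α B ≤ d := by
  have hg : (∃ B : Finset M, StrongIn α B ∧ delta α B = d) ∧
      (∀ B : Finset M, StrongIn α B → delta α B ≤ d) ↔
      IsGreatest {q | ∃ B : Finset M, StrongIn α B ∧ q = delta α B} d := by
    constructor
    · rintro ⟨⟨B, hB, hd⟩, h⟩
      refine ⟨⟨B, hB, hd.symm⟩, ?_⟩
      rintro _ ⟨B, hB, rfl⟩
      exact h B hB
    · rintro ⟨⟨B, hB, hd⟩, h⟩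
      exact ⟨⟨B, hB, hd.symm⟩, fun B hB => h ⟨B, hB, rfl⟩⟩
  rw [hg, dim, relDim, dim_set_eq har hM]
  split_ifs with h
  · rw [WithTop.coe_inj]
    constructor
    · intro hd
      exact hd ▸ h.choose_spec
    · intro hd
      exact h.choose_spec.unique hd
  · constructor
    · intro h'
      exact absurd h' WithTop.top_ne_coe
    · intro h'
      exact absurd ⟨d, h'⟩ h

theorem exists_coe_of_dim_ne_top (har : ∀ E : (Σ n, L.Relations n), 2 ≤ E.1) (hM : InKBar α M)
    (h : dim α M ≠ ⊤) :
    ∃ k : ℕ, dim α M = (((k : ℚ) / (commonDenom α : ℚ) : ℚ) : WithTop ℚ) := by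
  obtain ⟨d, hd⟩ := WithTop.ne_top_iff_exists.1 h
  obtain ⟨⟨B, -, hB⟩, -⟩ := (dim_eq_coe_iff har hM d).1 hd.symm
  obtain ⟨k, hk⟩ := hM.exists_delta_eq B
  exact ⟨k, by rw [← hd, ← hB, hk]⟩

/-- Ranks being multiples of `1/c`, a bounded set of ranks has a maximum. -/
theorem exists_le_delta_of_dim_eq_top (har : ∀ E : (Σ n, L.Relations n), 2 ≤ E.1)
    (hM : InKBar α M) (h : dim α M = ⊤) (r : ℚ) : ∃ B : Finset M, StrongIn α B ∧ r ≤ delta α B := by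
  by_contra! hr
  have hc : (0 : ℚ) < commonDenom α := by exact_mod_cast commonDenom_pos
  let T : Set ℕ := {k | ∃ B : Finset M, StrongIn α B ∧
    delta α B = (k : ℚ) / (commonDenom α : ℚ)}
  have hT : T.Nonempty := by
    obtain ⟨Y, -, hY⟩ := hM.exists_strongIn ∅
    obtain ⟨k, hk⟩ := hM.exists_delta_eq Y
    exact ⟨k, Y, hY, hk⟩
  have hbdd : BddAbove T := by
    refine ⟨⌈r * commonDenom α⌉₊, ?_⟩
    rintro k ⟨B, hB, hk⟩
    have h1 := hr B hB
    rw [hk, div_lt_iff₀ hc] at h1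
    exact_mod_cast (h1.le.trans (Nat.le_ceil _))
  obtain ⟨B, hB, hk⟩ := Nat.sSup_mem hT hbdd
  have : dim α M = ((((sSup T : ℕ) : ℚ) / (commonDenom α : ℚ) : ℚ) : WithTop ℚ) := by
    rw [dim_eq_coe_iff har hM]
    refine ⟨⟨B, hB, hk⟩, fun B' hB' => ?_⟩
    obtain ⟨k', hk'⟩ := hM.exists_delta_eq B'
    rw [hk']
    refine div_le_div_of_nonneg_right ?_ hc.le
    exact_mod_cast le_csSup hbdd (⟨B', hB', hk'⟩ : k' ∈ T)
  exact absurd (h.symm.trans this) WithTop.top_ne_coe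

end Dimension

/-! ### Fraïssé classes and generics -/

section Generic

theorem mem_KRank_iff {k : ℕ} {A : Bundled.{0} L.Structure} [Finite A] :
    A ∈ KRank α k ↔ InKBar α A ∧ delta α (whole A) = (k : ℚ) / (commonDenom α : ℚ) := by
  constructor
  · rintro ⟨hA, X, hX, hd⟩
    rw [eq_whole hX] at hd
    exact ⟨hA.2, hd⟩
  · rintro ⟨hA, hd⟩
    exact ⟨⟨inferInstance, hA⟩, whole A, mem_whole, hd⟩

theorem KRank_subset (k : ℕ) : KRank (L := L) α k ⊆ K α := fun _ hA => hA.1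

theorem isFraisseClass_K [L.IsRelational] (har : ∀ E : (Σ n, L.Relations n), 2 ≤ E.1)
    (hα : ∀ E, 0 ≤ α E) :
    IsFraisseClass α (K (L := L) α) where
  joint_embedding := by
    rintro A ⟨_, hA⟩ B ⟨_, hB⟩
    obtain ⟨D, hD, i, j, hDK, hi, hj, -⟩ := exists_sum har hα hA hB
    exact ⟨D, ⟨hD, hDK⟩, i, j, hi, hj⟩
  amalgamation := by
    rintro A ⟨_, hA⟩ B ⟨_, hB⟩ C ⟨_, hC⟩ e f he hf
    obtain ⟨D, hD, i, j, hDK, hij, hj, hi, -⟩ := exists_freeAmalgam hα hB hC he f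
    exact ⟨D, ⟨hD, hDK⟩, i, j, hi hf, hj, hij⟩

/-- Free amalgams of structures of equal rank have the same rank; for joint embeddings, the rank
of the disjoint union is lowered to the common rank of the two structures. -/
theorem isFraisseClass_KRank [L.IsRelational] (har : ∀ E : (Σ n, L.Relations n), 2 ≤ E.1)
    [Nonempty (Σ n, L.Relations n)] (hα : ∀ E, 0 < α E ∧ α E < 1) (k : ℕ) :
    IsFraisseClass α (KRank (L := L) α k) where
  joint_embedding := by
    intro A hA' B hB'
    have := hA'.1.1
    have := hB'.1.1
    have hα0 : ∀ E, 0 ≤ α E := fun E => (hα E).1.le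
    obtain ⟨hA, hdA⟩ := mem_KRank_iff.1 hA'
    obtain ⟨hB, hdB⟩ := mem_KRank_iff.1 hB'
    obtain ⟨F, _, i, j, hF, hi, hj, -⟩ := exists_sum har hα0 hA hB
    obtain ⟨D, _, h, hD, hdD, hst⟩ := exists_lower har hα hF hA
    refine ⟨D, mem_KRank_iff.2 ⟨hD, hdD.trans hdA⟩, h.comp i, h.comp j, ?_, ?_⟩
    · have := hst _ (isStrongEmb_iff.1 hi) (by rw [delta_map])
      rw [Finset.map_map] at this
      exact isStrongEmb_iff.2 this
    · have := hst _ (isStrongEmb_iff.1 hj) (by rw [delta_map, hdA, hdB])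
      rw [Finset.map_map] at this
      exact isStrongEmb_iff.2 this
  amalgamation := by
    intro A hA' B hB' C hC' e f he hf
    have := hA'.1.1
    have := hB'.1.1
    have := hC'.1.1
    obtain ⟨hA, hdA⟩ := mem_KRank_iff.1 hA'
    obtain ⟨hB, hdB⟩ := mem_KRank_iff.1 hB'
    obtain ⟨hC, hdC⟩ := mem_KRank_iff.1 hC'
    obtain ⟨D, hD, i, j, hDK, hij, hj, hi, hd⟩ :=
      exists_freeAmalgam (fun E => (hα E).1.le) hB hC he f
    refine ⟨D, mem_KRank_iff.2 ⟨hDK, ?_⟩, i, j, hi hf, hj, hij⟩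
    rw [hdA, hdB, hdC] at hd
    linarith

variable {M : Type w} [L.Structure M]

/-- If the strong finite subsets in `C` are cofinal, a countable structure is the union of a chain
of them. -/
theorem exists_strong_chain [Countable M] {C : Set (Bundled.{0} L.Structure)}
    (h : ∀ X : Finset M, ∃ Y : Finset M, X ⊆ Y ∧ StrongIn α Y ∧ IsMember C Y) :
    ∃ A : ℕ → Finset M, (∀ i, IsMember C (A i)) ∧ (∀ i, StrongPair α (A i) (A (i + 1))) ∧
      ∀ x : M, ∃ i, x ∈ A i := by
  classical
  obtain ⟨enc, henc⟩ := Countable.exists_injective_nat M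
  choose Y hY hs hC using h
  let next : ℕ → Finset M → Finset M := fun n X =>
    Y (X ∪ if h : ∃ x, enc x = n then {h.choose} else ∅)
  let A : ℕ → Finset M := fun n => Nat.rec (Y ∅) next n
  have hA : ∀ n, A (n + 1) = next n (A n) := fun n => rfl
  have hsub : ∀ n, A n ⊆ A (n + 1) := by
    intro n
    rw [hA]
    exact Finset.subset_union_left.trans (hY _)
  have hstr : ∀ n, StrongIn α (A n) := by
    rintro (_ | n)
    · exact hs _
    · exact hs _
  refine ⟨A, ?_, fun n => hstr n _ (hsub n), fun x => ⟨enc x + 1, ?_⟩⟩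
  · rintro (_ | n)
    · exact hC _
    · exact hC _
  · rw [hA]
    refine hY _ (Finset.mem_union_right _ ?_)
    have hex : ∃ y, enc y = enc x := ⟨x, rfl⟩
    rw [dif_pos hex, henc hex.choose_spec]
    exact Finset.mem_singleton_self x

theorem isMember_K [L.IsRelational] (hM : InKBar α M) (X : Finset M) :
    IsMember (K (L := L) α) X := by
  obtain ⟨A, hA, f, hf⟩ := exists_copy (L := L) X
  refine ⟨A, ⟨hA, hM.of_emb f⟩, f, ?_⟩
  rw [← hf, Finset.coe_map]
  ext x
  simp only [Set.mem_range, Set.mem_image, Finset.mem_coe, mem_whole, true_and]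
  rfl

theorem isMember_KRank [L.IsRelational] (hM : InKBar α M) {X : Finset M} {k : ℕ}
    (hX : delta α X = (k : ℚ) / (commonDenom α : ℚ)) : IsMember (KRank (L := L) α k) X := by
  obtain ⟨A, ⟨hA, hAK⟩, f, hf⟩ := isMember_K hM X
  refine ⟨A, mem_KRank_iff.2 ⟨hAK, ?_⟩, f, hf⟩
  have : (whole A).map f.toEmbedding = X := by
    apply Finset.coe_injective
    rw [← hf, Finset.coe_map]
    ext x
    simp only [Set.mem_range, Set.mem_image, Finset.mem_coe, mem_whole, true_and]
    rfl
  rw [← hX, ← this, delta_map]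

/-- Over a strong `f(A)` of maximal rank, the extensions provided by the theory are strong. -/
theorem isGeneric_KRank_of_models [L.IsRelational] (har : ∀ E : (Σ n, L.Relations n), 2 ≤ E.1)
    [Countable M] (hM : M ⊨ S α) {k : ℕ}
    (hk : dim α M = (((k : ℚ) / (commonDenom α : ℚ) : ℚ) : WithTop ℚ)) :
    IsGeneric α (KRank α k) M := by
  classical
  have hMK := inKBar_of_models hM
  obtain ⟨⟨B₀, hB₀, hd₀⟩, hmax⟩ := (dim_eq_coe_iff har hMK _).1 hk
  refine ⟨inferInstance, hMK, exists_strong_chain fun X => ?_, ?_⟩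
  · obtain ⟨Y, hXY, hY⟩ := hMK.exists_strongIn (X ∪ B₀)
    refine ⟨Y, Finset.subset_union_left.trans hXY, hY, isMember_KRank hMK ?_⟩
    refine le_antisymm (hmax Y hY) ?_
    rw [← hd₀]
    exact strongIn_iff.1 hB₀ Y (Finset.subset_union_right.trans hXY)
  · intro A hA' B hB' e he f hf
    have := hA'.1.1
    have := hB'.1.1
    obtain ⟨hA, hdA⟩ := mem_KRank_iff.1 hA'
    obtain ⟨hB, hdB⟩ := mem_KRank_iff.1 hB'
    obtain ⟨g, rfl⟩ := exists_extension_of_models hM hB he f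
    exact ⟨g, isStrongEmb_of_delta_le hf (by rw [hdA, hdB]), rfl⟩

/-- In infinite dimension `f(A)` lies in a strong `C ⊆ M` with `δ(B) ≤ δ(C)`; the free amalgam of
`B` and `C` over `A`, lowered to the rank of `C`, embeds in `M` over `C`, and strongly so. -/
theorem isGeneric_K_of_models [L.IsRelational] (har : ∀ E : (Σ n, L.Relations n), 2 ≤ E.1)
    [Nonempty (Σ n, L.Relations n)] (hα : ∀ E, 0 < α E ∧ α E < 1) [Countable M]
    (hM : M ⊨ S α) (htop : dim α M = ⊤) : IsGeneric α (K α) M := by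
  classical
  have hα0 : ∀ E, 0 ≤ α E := fun E => (hα E).1.le
  have hMK := inKBar_of_models hM
  refine ⟨inferInstance, hMK, exists_strong_chain fun X => ?_, ?_⟩
  · obtain ⟨Y, hXY, hY⟩ := hMK.exists_strongIn X
    exact ⟨Y, hXY, hY, isMember_K hMK Y⟩
  · rintro A ⟨_, hA⟩ B ⟨_, hB⟩ e he f hf
    obtain ⟨Y, hY, hBY⟩ := exists_le_delta_of_dim_eq_top har hMK htop (delta α (whole B))
    obtain ⟨Z, hZ', hZ⟩ := hMK.exists_strongIn ((whole A).map f.toEmbedding ∪ Y)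
    obtain ⟨C, _, c, rfl⟩ := exists_copy (L := L) Z
    have hBC : delta α (whole B) ≤ delta α (whole C) := by
      rw [← delta_map (α := α) c]
      exact hBY.trans (strongIn_iff.1 hY _ (Finset.subset_union_right.trans hZ'))
    have hc : IsStrongEmb α c := isStrongEmb_iff.2 hZ
    obtain ⟨f', hcf, hf'⟩ := exists_factor hα0 hf (c := c)
      (Finset.subset_union_left.trans hZ')
    obtain ⟨F, _, i, j, hF, hij, hj, hi, -⟩ := exists_freeAmalgam hα0 hB (hMK.of_emb c) he f'
    obtain ⟨D, _, h, hD, hdD, hst⟩ := exists_lower har hα hF (hMK.of_emb c)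
    have hhj : IsStrongEmb α (h.comp j) := by
      have := hst _ (isStrongEmb_iff.1 hj) (by rw [delta_map])
      rw [Finset.map_map] at this
      exact isStrongEmb_iff.2 this
    have hhi : IsStrongEmb α (h.comp i) := by
      have := hst _ (isStrongEmb_iff.1 (hi hf')) (by rwa [delta_map])
      rw [Finset.map_map] at this
      exact isStrongEmb_iff.2 this
    obtain ⟨g, hg⟩ := exists_extension_of_models hM hD hhj c
    have hgs : IsStrongEmb α g := isStrongEmb_of_delta_le (k := h.comp j) (hg ▸ hc) hdD.le
    refine ⟨g.comp (h.comp i), hgs.comp hα0 hhi, ?_⟩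
    rw [← hcf, ← hg]
    ext a
    have := DFunLike.congr_fun hij a
    exact congrArg (fun x => g (h x)) this

/-- The generic of `K_α` strongly embeds structures of arbitrarily large rank. -/
theorem dim_eq_top_of_isGeneric [L.IsRelational] (har : ∀ E : (Σ n, L.Relations n), 2 ≤ E.1)
    (hM : IsGeneric α (K α) M) : dim α M = ⊤ := by
  by_contra hne
  obtain ⟨k, hk⟩ := exists_coe_of_dim_ne_top har hM.mem_KBar hne
  obtain ⟨-, hmax⟩ := (dim_eq_coe_iff har hM.mem_KBar _).1 hk
  obtain ⟨A, _, hA, hcard, -⟩ := exists_free_points (L := L) (α := α) 0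
  obtain ⟨B, _, hB, -, hdB⟩ := exists_free_points (L := L) (α := α) (k + 1)
  have : IsEmpty A := (Finite.card_eq_zero_iff).1 hcard
  obtain ⟨e, he⟩ := exists_strongEmb_of_isEmpty har hA.1 hB
  obtain ⟨f, hf⟩ := exists_strongEmb_of_isEmpty har hA.1 hM.mem_KBar
  obtain ⟨g, hg, -⟩ := hM.extension A ⟨inferInstance, hA⟩ B ⟨inferInstance, hB⟩ e he f hf
  have h1 := hmax _ (isStrongEmb_iff.1 hg)
  rw [delta_map, hdB] at h1
  have hc : (1 : ℚ) ≤ commonDenom α := by exact_mod_cast commonDenom_pos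
  have h2 : (k : ℚ) / (commonDenom α : ℚ) ≤ k := div_le_self (by positivity) hc
  push_cast at h1
  linarith

end Generic

end

section

open EdgeFamily

variable {L : FirstOrder.Language.{u, v}}
variable [Fintype (Σ n, L.Relations n)] {α : (Σ n, L.Relations n) → ℚ}

/-! ### Uniqueness of generics -/

section

variable {M N : Type*} [L.Structure M] [L.Structure N]

theorem StrongPair.trans (hα : ∀ E, 0 ≤ α E) {X Y Z : Finset M} (hXY : StrongPair α X Y)
    (hYZ : StrongPair α Y Z) : StrongPair α X Z := by
  classical
  refine ⟨hXY.1.trans hYZ.1, fun W hXW hWZ => ?_⟩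
  have h1 := delta_submodular hα W Y
  have h2 := hYZ.2 (W ∪ Y) Finset.subset_union_right (Finset.union_subset hWZ hYZ.1)
  have h3 := hXY.2 (W ∩ Y) (Finset.subset_inter hXW hXY.1) Finset.inter_subset_right
  linarith

/-- In a generic, the strong finite substructures in the class are cofinal. -/
theorem IsGeneric.exists_strongEmb (hα : ∀ E, 0 ≤ α E) {C : Set (Bundled.{0} L.Structure)}
    (hM : IsGeneric α C M) (X : Finset M) :
    ∃ B ∈ C, ∃ b : B ↪[L] M, IsStrongEmb α b ∧ (X : Set M) ⊆ Set.range b := by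
  classical
  obtain ⟨A, hAC, hA, hcov⟩ := hM.chain
  have hpair : ∀ i k, StrongPair α (A i) (A (i + k)) := by
    intro i k
    induction k with
    | zero => exact ⟨subset_rfl, fun Z h _ => (subset_antisymm h ‹_›) ▸ le_rfl⟩
    | succ k ih => exact ih.trans hα (hA _)
  have hmono : Monotone A := monotone_nat_of_le_succ fun i => (hA i).1
  have hfin : ∀ X : Finset M, ∃ i, X ⊆ A i := by
    intro X
    induction X using Finset.induction_on with
    | empty => exact ⟨0, Finset.empty_subset _⟩
    | insert x X _ ih =>
      obtain ⟨i, hi⟩ := ih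
      obtain ⟨j, hj⟩ := hcov x
      exact ⟨max i j, Finset.insert_subset (hmono (le_max_right i j) hj)
        (hi.trans (hmono (le_max_left i j)))⟩
  have hstr : ∀ i, StrongIn α (A i) := by
    intro i
    rw [strongIn_iff]
    intro Y hY
    obtain ⟨j, hj⟩ := hfin Y
    exact (hpair i j).2 Y hY (hj.trans (hmono (Nat.le_add_left j i)))
  obtain ⟨i, hi⟩ := hfin X
  obtain ⟨B, hB, b, hb⟩ := hAC i
  refine ⟨B, hB, b, ⟨A i, hb.symm, hstr i⟩, ?_⟩
  rw [hb]
  exact_mod_cast hi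

/-- `T` is the graph of an isomorphism between strong finite substructures of `M` and `N` that
belong to `C`. -/
def IsPartialIso (α : (Σ n, L.Relations n) → ℚ) (C : Set (Bundled.{0} L.Structure))
    (T : Finset (M × N)) : Prop :=
  ∃ A ∈ C, ∃ (f : A ↪[L] M) (g : A ↪[L] N), IsStrongEmb α f ∧ IsStrongEmb α g ∧
    (T : Set (M × N)) = Set.range fun a => (f a, g a)

theorem IsPartialIso.swap [DecidableEq M] [DecidableEq N] {C : Set (Bundled.{0} L.Structure)}
    {T : Finset (M × N)} (hT : IsPartialIso α C T) : IsPartialIso α C (T.image Prod.swap) := by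
  obtain ⟨A, hA, f, g, hf, hg, hT⟩ := hT
  refine ⟨A, hA, g, f, hg, hf, ?_⟩
  rw [Finset.coe_image, hT, ← Set.range_comp]
  rfl

/-- The forth step; the back step is its image under `IsPartialIso.swap`. -/
theorem IsPartialIso.exists_extend [L.IsRelational] (hα : ∀ E, 0 ≤ α E)
    {C : Set (Bundled.{0} L.Structure)} (hM : IsGeneric α C M) (hN : IsGeneric α C N)
    {T : Finset (M × N)} (hT : IsPartialIso α C T) (m : M) :
    ∃ T' : Finset (M × N), T ⊆ T' ∧ IsPartialIso α C T' ∧ ∃ n, (m, n) ∈ T' := by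
  classical
  obtain ⟨A, hA, f, g, hf, hg, hT⟩ := hT
  have := hf.finite
  obtain ⟨B, hB, b, hb, hXb⟩ := hM.exists_strongEmb hα (insert m ((whole A).map f.toEmbedding))
  have := hb.finite
  have hXb' : insert m ((whole A).map f.toEmbedding) ⊆ (whole B).map b.toEmbedding := by
    intro x hx
    obtain ⟨y, rfl⟩ := hXb hx
    exact Finset.mem_map.2 ⟨y, mem_whole y, rfl⟩
  obtain ⟨e, hbe, he⟩ := exists_factor hα hf ((Finset.subset_insert _ _).trans hXb')
  obtain ⟨k, hk, hke⟩ := hN.extension A hA B hB e he g hg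
  refine ⟨(whole B).image fun x => (b x, k x), ?_, ⟨B, hB, b, k, hb, hk, ?_⟩, ?_⟩
  · rw [← Finset.coe_subset, hT]
    rintro _ ⟨a, rfl⟩
    rw [Finset.mem_coe, Finset.mem_image]
    exact ⟨e a, mem_whole _, Prod.ext (DFunLike.congr_fun hbe a) (DFunLike.congr_fun hke a)⟩
  · ext x
    simp
  · obtain ⟨y, -, hy⟩ := Finset.mem_map.1 (hXb' (Finset.mem_insert_self _ _))
    exact ⟨k y, Finset.mem_image.2 ⟨y, mem_whole y, Prod.ext hy rfl⟩⟩

/-- Any two generics of a class with joint embedding are isomorphic. -/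
theorem nonempty_equiv_of_isGeneric [L.IsRelational] (hα : ∀ E, 0 ≤ α E)
    {C : Set (Bundled.{0} L.Structure)} (hC : IsFraisseClass α C) (hM : IsGeneric α C M)
    (hN : IsGeneric α C N) : Nonempty (M ≃[L] N) := by
  classical
  have := hM.countable
  have := hN.countable
  have := Encodable.ofCountable (M ⊕ N)
  let P : Type _ := {T : Finset (M × N) // IsPartialIso α C T}
  obtain ⟨p₀⟩ : Nonempty P := by
    obtain ⟨A, hA, f, hf, -⟩ := hM.exists_strongEmb hα ∅
    obtain ⟨B, hB, g, hg, -⟩ := hN.exists_strongEmb hα ∅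
    obtain ⟨D, hD, i, j, hi, hj⟩ := hC.joint_embedding A hA B hB
    obtain ⟨f', hf', -⟩ := hM.extension A hA D hD i hi f hf
    obtain ⟨g', hg', -⟩ := hN.extension B hB D hD j hj g hg
    have := hf'.finite
    refine ⟨⟨(whole D).image fun x => (f' x, g' x), D, hD, f', g', hf', hg', ?_⟩⟩
    ext x
    simp
  let cof : M ⊕ N → Order.Cofinal P := Sum.elim
    (fun m => ⟨{T | ∃ n, (m, n) ∈ T.1}, fun T => by
      obtain ⟨T', hTT', hT', hn⟩ := T.2.exists_extend hα hM hN m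
      exact ⟨⟨T', hT'⟩, hn, hTT'⟩⟩)
    (fun n => ⟨{T | ∃ m, (m, n) ∈ T.1}, fun T => by
      obtain ⟨T', hTT', hT', m, hm⟩ := T.2.swap.exists_extend hα hN hM n
      refine ⟨⟨T'.image Prod.swap, hT'.swap⟩, ⟨m, Finset.mem_image.2 ⟨_, hm, rfl⟩⟩, ?_⟩
      intro x hx
      exact Finset.mem_image.2 ⟨x.swap, hTT' (Finset.mem_image_of_mem _ hx), Prod.swap_swap x⟩⟩)
  let I := Order.idealOfCofinals p₀ cof
  have hdir : ∀ s : Finset (M × N), (∀ x ∈ s, ∃ T ∈ I, x ∈ T.1) → ∃ T ∈ I, s ⊆ T.1 := by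
    intro s
    induction s using Finset.induction_on with
    | empty => exact fun _ => ⟨p₀, Order.mem_idealOfCofinals _ _, Finset.empty_subset _⟩
    | insert x s _ ih =>
      intro h
      obtain ⟨T, hT, hsT⟩ := ih fun y hy => h y (Finset.mem_insert_of_mem hy)
      obtain ⟨T', hT', hxT'⟩ := h x (Finset.mem_insert_self x s)
      obtain ⟨U, hU, hTU, hTU'⟩ := I.directed T hT T' hT'
      exact ⟨U, hU, Finset.insert_subset (hTU' hxT') (hsT.trans hTU)⟩
  have hleft : ∀ m, ∃ n, ∃ T ∈ I, (m, n) ∈ T.1 := by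
    intro m
    obtain ⟨T, ⟨n, hn⟩, hT⟩ := Order.cofinal_meets_idealOfCofinals p₀ cof (Sum.inl m)
    exact ⟨n, T, hT, hn⟩
  have hright : ∀ n, ∃ m, ∃ T ∈ I, (m, n) ∈ T.1 := by
    intro n
    obtain ⟨T, ⟨m, hm⟩, hT⟩ := Order.cofinal_meets_idealOfCofinals p₀ cof (Sum.inr n)
    exact ⟨m, T, hT, hm⟩
  have huniq : ∀ m n m' n', (∃ T ∈ I, (m, n) ∈ T.1) → (∃ T ∈ I, (m', n') ∈ T.1) →
      (m = m' ↔ n = n') := by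
    intro m n m' n' h h'
    obtain ⟨⟨T, A, hA, f, g, hf, hg, hT⟩, hTI, hsT⟩ := hdir {(m, n), (m', n')} (by
      intro x hx
      rcases Finset.mem_insert.1 hx with rfl | hx
      · exact h
      · rw [Finset.mem_singleton.1 hx]
        exact h')
    have h1 : (m, n) ∈ (T : Set (M × N)) := hsT (by simp)
    have h2 : (m', n') ∈ (T : Set (M × N)) := hsT (by simp)
    rw [hT] at h1 h2
    obtain ⟨a, ha⟩ := h1
    obtain ⟨a', ha'⟩ := h2
    obtain ⟨rfl, rfl⟩ := Prod.mk.inj ha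
    obtain ⟨rfl, rfl⟩ := Prod.mk.inj ha'
    rw [f.injective.eq_iff, g.injective.eq_iff]
  choose φ hφ using hleft
  choose ψ hψ using hright
  refine ⟨⟨⟨φ, ψ, fun m => ?_, fun n => ?_⟩, fun f => isEmptyElim f, fun {k} E x => ?_⟩⟩
  · exact (huniq _ _ _ _ (hψ (φ m)) (hφ m)).2 rfl
  · exact (huniq _ _ _ _ (hφ (ψ n)) (hψ n)).1 rfl
  · obtain ⟨⟨T, A, hA, f, g, hf, hg, hT⟩, hTI, hsT⟩ :=
      hdir (Finset.univ.image fun i => (x i, φ (x i))) (by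
        intro y hy
        obtain ⟨i, -, rfl⟩ := Finset.mem_image.1 hy
        exact hφ (x i))
    have hmem : ∀ i, ∃ a, f a = x i ∧ g a = φ (x i) := by
      intro i
      have h1 : (x i, φ (x i)) ∈ (T : Set (M × N)) :=
        hsT (Finset.mem_image.2 ⟨i, Finset.mem_univ i, rfl⟩)
      rw [hT] at h1
      obtain ⟨a, ha⟩ := h1
      exact ⟨a, Prod.mk.inj ha⟩
    choose y hy using hmem
    have h1 : x = f ∘ y := funext fun i => ((hy i).1).symm
    have h2 : φ ∘ x = g ∘ y := funext fun i => ((hy i).2).symm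
    change Language.Structure.RelMap E (φ ∘ x) ↔ _
    rw [h2, h1]
    exact (g.map_rel E y).trans (f.map_rel E y).symm

theorem StrongIn.map_equiv {X : Finset M} (hX : StrongIn α X) (e : M ≃[L] N) :
    StrongIn α (X.map e.toEmbedding.toEmbedding) := by
  classical
  rw [strongIn_iff] at hX ⊢
  intro Y hY
  have h1 : (pull e.toEmbedding.toEmbedding Y).map e.toEmbedding.toEmbedding = Y := by
    ext y
    simp only [Finset.mem_map, mem_pull]
    constructor
    · rintro ⟨a, ha, rfl⟩
      exact ha
    · intro hy
      have hey : e.toEmbedding.toEmbedding (e.symm y) = y := e.apply_symm_apply y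
      exact ⟨e.symm y, by rwa [hey], hey⟩
  rw [delta_map, ← h1, delta_map]
  exact hX _ (subset_pull.2 hY)

theorem dim_eq_coe_of_equiv (har : ∀ E : (Σ n, L.Relations n), 2 ≤ E.1) (hM : InKBar α M)
    (hN : InKBar α N) (e : M ≃[L] N) {d : ℚ} (hd : dim α M = d) : dim α N = d := by
  rw [dim_eq_coe_iff har hM] at hd
  rw [dim_eq_coe_iff har hN]
  obtain ⟨⟨B, hB, hd⟩, hmax⟩ := hd
  refine ⟨⟨_, hB.map_equiv e, by rw [delta_map, hd]⟩, fun B' hB' => ?_⟩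
  rw [← delta_map e.symm.toEmbedding]
  exact hmax _ (hB'.map_equiv e.symm)

theorem dim_congr (har : ∀ E : (Σ n, L.Relations n), 2 ≤ E.1) (hM : InKBar α M)
    (hN : InKBar α N) (e : M ≃[L] N) : dim α M = dim α N := by
  by_cases h : dim α M = ⊤
  · by_cases h' : dim α N = ⊤
    · rw [h, h']
    · obtain ⟨d, hd⟩ := WithTop.ne_top_iff_exists.1 h'
      rw [← hd]
      exact dim_eq_coe_of_equiv har hN hM e.symm hd.symm
  · obtain ⟨d, hd⟩ := WithTop.ne_top_iff_exists.1 h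
    rw [← hd]
    exact (dim_eq_coe_of_equiv har hM hN e hd.symm).symm

end

end

section

open EdgeFamily

variable {L : FirstOrder.Language.{u, v}}
variable [Fintype (Σ n, L.Relations n)] {α : (Σ n, L.Relations n) → ℚ}

/-! ### A countable model of each integer dimension -/

/-- A finite approximation, of rank `d`, to a model of dimension `d`: a finite set of natural
numbers and the hyperedges on it. Members of `fam` not contained in `verts` are irrelevant. -/
structure Approx (α : (Σ n, L.Relations n) → ℚ) (d : ℚ) where
  /-- The vertices decided so far. -/
  verts : Finset ℕ
  /-- The hyperedges. -/
  fam : EdgeFamily (Σ n, L.Relations n) ℕ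
  uniform : Uniform (fun E => E.1) fam
  rank_nonneg : ∀ X ⊆ verts, 0 ≤ rank α fam X
  rank_verts : rank α fam verts = d

namespace Approx

variable {d : ℚ}

/-- Approximations are ordered by strong extension. -/
instance : Preorder (Approx α d) where
  le p q := p.verts ⊆ q.verts ∧ (∀ E, ∀ s ⊆ p.verts, s ∈ p.fam E ↔ s ∈ q.fam E) ∧
    ∀ Z ⊆ q.verts, rank α p.fam (Z ∩ p.verts) ≤ rank α q.fam Z
  le_refl p := ⟨subset_rfl, fun _ _ _ => Iff.rfl, fun Z h => by
    rw [Finset.inter_eq_left.2 h]⟩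
  le_trans p q r := by
    rintro ⟨h1, h2, h3⟩ ⟨h4, h5, h6⟩
    refine ⟨h1.trans h4, fun E s hs => (h2 E s hs).trans (h5 E s (hs.trans h1)), fun Z hZ => ?_⟩
    have h := h3 (Z ∩ q.verts) Finset.inter_subset_right
    rw [Finset.inter_assoc, Finset.inter_eq_right.2 h1] at h
    exact h.trans (h6 Z hZ)

/-- New elements are placed beyond the old ones. -/
theorem exists_embedding_extend {C D : Type*} [Finite D] (h : C ↪ D) (c : C ↪ ℕ) :
    ∃ φ : D ↪ ℕ, ∀ a, φ (h a) = c a := by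
  classical
  have : Finite C := Finite.of_injective h h.injective
  obtain ⟨ψ, hψ⟩ := Countable.exists_injective_nat D
  obtain ⟨N, hN⟩ := (Set.finite_range c).bddAbove
  let φ : D → ℕ := fun x => if hx : ∃ a, h a = x then c hx.choose else N + 1 + ψ x
  have h1 : ∀ a, φ (h a) = c a := by
    intro a
    have hx : ∃ a', h a' = h a := ⟨a, rfl⟩
    simp only [φ, dif_pos hx]
    rw [h.injective hx.choose_spec]
  have h2 : ∀ x, (¬ ∃ a, h a = x) → φ x = N + 1 + ψ x := fun x hx => dif_neg hx
  have hle : ∀ a, c a ≤ N := fun a => hN (Set.mem_range_self a)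
  refine ⟨⟨φ, fun x y hxy => ?_⟩, h1⟩
  by_cases hx : ∃ a, h a = x <;> by_cases hy : ∃ a, h a = y
  · obtain ⟨a, rfl⟩ := hx
    obtain ⟨b, rfl⟩ := hy
    rw [h1, h1] at hxy
    rw [c.injective hxy]
  · obtain ⟨a, rfl⟩ := hx
    rw [h1, h2 y hy] at hxy
    have := hle a
    omega
  · obtain ⟨b, rfl⟩ := hy
    rw [h1, h2 x hx] at hxy
    have := hle b
    omega
  · rw [h2 x hx, h2 y hy] at hxy
    exact hψ (by omega)

/-- An approximation as a member of `K_α`. -/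
theorem exists_structure [L.IsRelational] (p : Approx (L := L) α d) :
    ∃ (C : Bundled.{0} L.Structure) (_ : Finite C) (c : C ↪ ℕ), InKBar α C ∧
      IsEmb (edges (L := L) C) p.fam c ∧ (whole C).map c = p.verts ∧
      delta α (whole C) = d := by
  let _ : L.Structure ℕ := ofHypergraph p.fam
  have hH : IsHypergraph L ℕ := isHypergraph_ofHypergraph p.fam
  have hedges : edges (L := L) ℕ = p.fam := edges_ofHypergraph p.uniform
  obtain ⟨C, hC, c, hc⟩ := exists_copy (L := L) p.verts
  refine ⟨C, hC, c.toEmbedding, ⟨hH.of_emb c, fun X => ?_⟩, hedges ▸ isEmb_edges c, hc, ?_⟩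
  · rw [← delta_map c, delta_eq_rank, hedges]
    exact p.rank_nonneg _ (hc ▸ Finset.map_subset_map.2 fun a _ => mem_whole a)
  · rw [← delta_map c, hc, delta_eq_rank, hedges, p.rank_verts]

/-- A strong extension of the same rank, realized by an approximation. -/
theorem exists_ge (hα : ∀ E, 0 ≤ α E) (p : Approx (L := L) α d) {C D : Type} [L.Structure C]
    [L.Structure D] [Finite C] [Finite D] {c : C ↪ ℕ} (hc : IsEmb (edges (L := L) C) p.fam c)
    (hcv : (whole C).map c = p.verts) (hD : InKBar α D) (hd : delta α (whole D) = d)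
    {h : C ↪[L] D} (hh : IsStrongEmb α h) :
    ∃ (q : Approx (L := L) α d) (φ : D ↪ ℕ), p ≤ q ∧ IsEmb (edges (L := L) D) q.fam φ ∧
      (∀ a, φ (h a) = c a) ∧ (whole D).map φ = q.verts := by
  obtain ⟨φ, hφ⟩ := exists_embedding_extend h.toEmbedding c
  have hφc : h.toEmbedding.trans φ = c := by
    ext a
    exact hφ a
  let H : EdgeFamily (Σ n, L.Relations n) ℕ :=
    fun E => {s | ∃ t ∈ edges (L := L) D E, t.map φ = s}
  have hH : IsEmb (edges (L := L) D) H φ := by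
    intro E s
    constructor
    · rintro ⟨t, ht, hts⟩
      rwa [← Finset.map_injective φ hts]
    · exact fun hs => ⟨s, hs, rfl⟩
  have hpull : ∀ Z ⊆ (whole D).map φ, (pull φ Z).map φ = Z := by
    intro Z hZ
    rw [map_pull_eq_inter, Finset.inter_eq_left.2 hZ]
  have hrank : ∀ Z ⊆ (whole D).map φ, rank α H Z = delta α (pull φ Z) := by
    intro Z hZ
    rw [delta_eq_rank, ← rank_map α hH, hpull Z hZ]
  refine ⟨⟨(whole D).map φ, H, ?_, fun Z hZ => ?_, ?_⟩, φ, ⟨?_, ?_, ?_⟩, hH, hφ, rfl⟩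
  · rintro E s ⟨t, ht, rfl⟩
    rw [Finset.card_map, uniform_edges hD.1 E t ht]
  · rw [hrank Z hZ]
    exact hD.2 _
  · rw [rank_map α hH, ← delta_eq_rank, hd]
  · rw [← hcv, ← hφc, ← Finset.map_map]
    exact Finset.map_subset_map.2 fun a _ => mem_whole a
  · intro E s hs
    rw [← hcv] at hs
    obtain ⟨t, -, rfl⟩ := Finset.subset_map_iff.1 hs
    rw [hc E t, ← hφc, ← Finset.map_map]
    exact (isEmb_edges h E t).symm.trans (hH E _).symm
  · intro Z hZ
    change rank α p.fam (Z ∩ p.verts) ≤ rank α H Z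
    rw [hrank Z hZ, ← hcv, ← map_pull_eq_inter, rank_map α hc, ← delta_eq_rank, ← hφc, pull_trans]
    exact hh.delta_pull_le hα _

end Approx

/-- An extension problem: a hypergraph on `Fin b`, a subset `base` and a map of `base` into `ℕ`
(the values of `map` outside `base` are irrelevant). -/
structure Problem (L : FirstOrder.Language.{u, v}) where
  /-- The size of the extension. -/
  size : ℕ
  /-- The hyperedges of the extension. -/
  fam : EdgeFamily (Σ n, L.Relations n) (Fin size)
  /-- The part that is already embedded. -/
  base : Finset (Fin size)
  /-- The embedding of the base. -/
  map : Fin size → ℕ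

instance : Countable (Problem L) := by
  let F : Problem L → Σ b : ℕ, EdgeFamily (Σ n, L.Relations n) (Fin b) × Finset (Fin b) ×
    (Fin b → ℕ) := fun r => ⟨r.size, r.fam, r.base, r.map⟩
  refine Function.Injective.countable (f := F) ?_
  rintro ⟨b, H, a, f⟩ ⟨b', H', a', f'⟩ h
  cases h
  rfl

namespace Problem

variable {d : ℚ}

/-- The extension is strong over the base and belongs to `K_α`. -/
structure Valid (α : (Σ n, L.Relations n) → ℚ) (r : Problem L) : Prop where
  uniform : Uniform (fun E => E.1) r.fam
  rank_nonneg : ∀ X, 0 ≤ rank α r.fam X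
  strong : ∀ Z, r.base ⊆ Z → rank α r.fam r.base ≤ rank α r.fam Z

/-- The map embeds the base in the approximation `p`. -/
structure Posed (r : Problem L) (p : Approx (L := L) α d) : Prop where
  mem : ∀ i ∈ r.base, r.map i ∈ p.verts
  inj : Set.InjOn r.map r.base
  edge : ∀ E, ∀ s ⊆ r.base, s.image r.map ∈ p.fam E ↔ s ∈ r.fam E

/-- The embedding of the base extends inside the approximation `p`. -/
def Solved (r : Problem L) (p : Approx (L := L) α d) : Prop :=
  ∃ g : Fin r.size ↪ ℕ, IsEmb r.fam p.fam g ∧ (∀ i, g i ∈ p.verts) ∧ ∀ i ∈ r.base, g i = r.map i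

/-- The free amalgam of the extension with the approximation, lowered to rank `d`, solves the
problem. -/
theorem exists_solved [L.IsRelational] (har : ∀ E : (Σ n, L.Relations n), 2 ≤ E.1)
    [Nonempty (Σ n, L.Relations n)] (hα : ∀ E, 0 < α E ∧ α E < 1) {r : Problem L}
    (hr : r.Valid α) {p : Approx (L := L) α d} (hp : r.Posed p) : ∃ q, p ≤ q ∧ r.Solved q := by
  have hα0 : ∀ E, 0 ≤ α E := fun E => (hα E).1.le
  obtain ⟨C, _, c, hC, hc, hcv, hdC⟩ := p.exists_structure
  let _ : L.Structure (Fin r.size) := ofHypergraph r.fam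
  have hH : IsHypergraph L (Fin r.size) := isHypergraph_ofHypergraph r.fam
  have hedges : edges (L := L) (Fin r.size) = r.fam := edges_ofHypergraph hr.uniform
  have hB : InKBar α (Fin r.size) :=
    ⟨hH, fun X => by rw [delta_eq_rank, hedges]; exact hr.rank_nonneg X⟩
  obtain ⟨A, _, e, he⟩ := exists_copy (L := L) r.base
  have hebase : ∀ a, e a ∈ r.base := fun a => he ▸ Finset.mem_map.2 ⟨a, mem_whole a, rfl⟩
  have hes : IsStrongEmb α e := by
    rw [isStrongEmb_iff, he, strongIn_iff]
    intro Y hY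
    rw [delta_eq_rank, delta_eq_rank, hedges]
    exact hr.strong Y hY
  have hmem : ∀ a : A, ∃ x : C, c x = r.map (e a) := by
    intro a
    have := hp.mem _ (hebase a)
    rw [← hcv] at this
    obtain ⟨x, -, hx⟩ := Finset.mem_map.1 this
    exact ⟨x, hx⟩
  choose f hf using hmem
  have hfinj : Function.Injective f := by
    intro a b hab
    refine e.injective (hp.inj (hebase a) (hebase b) ?_)
    rw [← hf, ← hf, hab]
  have hfemb : IsEmb (edges (L := L) A) (edges (L := L) C) ⟨f, hfinj⟩ := by
    classical
    intro E s
    have h1 : (s.map ⟨f, hfinj⟩).map c = (s.map e.toEmbedding).image r.map := by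
      ext x
      simp only [Finset.mem_map, Finset.mem_image, Function.Embedding.coeFn_mk,
        exists_exists_and_eq_and]
      constructor
      · rintro ⟨a, ha, rfl⟩
        exact ⟨a, ha, (hf a).symm⟩
      · rintro ⟨a, ha, rfl⟩
        exact ⟨a, ha, hf a⟩
    have h2 : s.map e.toEmbedding ⊆ r.base := by
      intro x hx
      obtain ⟨a, -, rfl⟩ := Finset.mem_map.1 hx
      exact hebase a
    rw [← hc E, h1, hp.edge E _ h2, ← hedges, isEmb_edges e E]
  let f' : A ↪[L] C := embOfIsEmb (hH.of_emb e) hC.1 ⟨f, hfinj⟩ hfemb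
  obtain ⟨F, _, i, j, hF, hij, hj, -, -⟩ := exists_freeAmalgam hα0 hB hC hes f'
  obtain ⟨D, _, h, hD, hdD, hst⟩ := exists_lower har hα hF hC
  have hhj : IsStrongEmb α (h.comp j) := by
    have := hst _ (isStrongEmb_iff.1 hj) (by rw [delta_map])
    rw [Finset.map_map] at this
    exact isStrongEmb_iff.2 this
  obtain ⟨q, φ, hpq, hφ, hφc, hφv⟩ := p.exists_ge hα0 hc hcv hD (hdD.trans hdC) hhj
  refine ⟨q, hpq, (h.comp i).toEmbedding.trans φ, ?_, ?_, ?_⟩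
  · intro E s
    rw [← Finset.map_map, hφ, isEmb_edges (h.comp i), hedges]
  · intro x
    rw [← hφv]
    exact Finset.mem_map.2 ⟨h (i x), mem_whole _, rfl⟩
  · intro x hx
    rw [← he] at hx
    obtain ⟨a, -, rfl⟩ := Finset.mem_map.1 hx
    have h1 : i (e a) = j (f' a) := DFunLike.congr_fun hij a
    change φ (h (i (e a))) = _
    rw [h1]
    exact (hφc (f' a)).trans (hf a)

end Problem

end

section

open EdgeFamily

variable {L : FirstOrder.Language.{u, v}}
variable [Fintype (Σ n, L.Relations n)] {α : (Σ n, L.Relations n) → ℚ}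

section Limit

variable {d : ℚ} (I : Order.Ideal (Approx (L := L) α d))

/-- The vertices decided by some approximation in the ideal. -/
abbrev LimitVerts : Type := {v : ℕ // ∃ p ∈ I, v ∈ p.verts}

/-- The hyperedges on the limit: those of any approximation, restricted to its vertices. -/
def limitFam : EdgeFamily (Σ n, L.Relations n) (LimitVerts I) :=
  fun E => {s | ∃ p ∈ I, s.map (Function.Embedding.subtype _) ⊆ p.verts ∧
    s.map (Function.Embedding.subtype _) ∈ p.fam E}

variable {I}

/-- Approximations agree on common vertices, the ideal being directed. -/
theorem mem_limitFam_iff {p : Approx (L := L) α d} (hp : p ∈ I) {s : Finset (LimitVerts I)}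
    (hs : s.map (Function.Embedding.subtype _) ⊆ p.verts) (E : Σ n, L.Relations n) :
    s.map (Function.Embedding.subtype _) ∈ p.fam E ↔ s ∈ limitFam I E := by
  constructor
  · exact fun h => ⟨p, hp, hs, h⟩
  · rintro ⟨q, hq, hsq, h⟩
    obtain ⟨r, -, hpr, hqr⟩ := I.directed p hp q hq
    exact (hpr.2.1 E _ hs).2 ((hqr.2.1 E _ hsq).1 h)

theorem uniform_limitFam : Uniform (fun E => E.1) (limitFam I) := by
  rintro E s ⟨p, -, -, h⟩
  rw [← p.uniform E _ h, Finset.card_map]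

theorem rank_limitFam {p : Approx (L := L) α d} (hp : p ∈ I) {X : Finset (LimitVerts I)}
    (hX : X.map (Function.Embedding.subtype _) ⊆ p.verts) :
    rank α (limitFam I) X = rank α p.fam (X.map (Function.Embedding.subtype _)) :=
  (rank_map_of_subset α fun E _ hs =>
    mem_limitFam_iff hp ((Finset.map_subset_map.2 hs).trans hX) E).symm

theorem exists_approx_of_finset (X : Finset (LimitVerts I)) :
    ∃ p ∈ I, X.map (Function.Embedding.subtype _) ⊆ p.verts := by
  classical
  induction X using Finset.induction_on with
  | empty =>
    obtain ⟨p, hp⟩ := I.nonempty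
    exact ⟨p, hp, by simp⟩
  | insert x X _ ih =>
    obtain ⟨p, hp, hX⟩ := ih
    obtain ⟨q, hq, hx⟩ := x.2
    obtain ⟨r, hr, hpr, hqr⟩ := I.directed p hp q hq
    refine ⟨r, hr, ?_⟩
    rw [Finset.map_insert]
    exact Finset.insert_subset (hqr.1 hx) (hX.trans hpr.1)

/-- The limit has dimension `d`: the vertex sets of the approximations are strong of rank `d`. -/
theorem dim_limit [L.IsRelational] (har : ∀ E : (Σ n, L.Relations n), 2 ≤ E.1)
    [L.Structure (LimitVerts I)] (hM : InKBar α (LimitVerts I))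
    (hedges : edges (L := L) (LimitVerts I) = limitFam I) :
    dim α (LimitVerts I) = (d : WithTop ℚ) := by
  classical
  have hX : ∀ p ∈ I, ∃ X : Finset (LimitVerts I),
      X.map (Function.Embedding.subtype _) = p.verts := by
    intro p hp
    refine ⟨pull (Function.Embedding.subtype _) p.verts, ?_⟩
    ext v
    simp only [Finset.mem_map, mem_pull]
    constructor
    · rintro ⟨x, hx, rfl⟩
      exact hx
    · exact fun hv => ⟨⟨v, p, hp, hv⟩, hv, rfl⟩
  have hdX : ∀ p ∈ I, ∀ X : Finset (LimitVerts I),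
      X.map (Function.Embedding.subtype _) = p.verts → delta α X = d := by
    intro p hp X hX
    rw [delta_eq_rank, hedges, rank_limitFam hp hX.subset, hX, p.rank_verts]
  rw [dim_eq_coe_iff har hM]
  constructor
  · obtain ⟨p, hp⟩ := I.nonempty
    obtain ⟨X, hXp⟩ := hX p hp
    refine ⟨X, strongIn_iff.2 fun Y hY => ?_, hdX p hp X hXp⟩
    obtain ⟨q, hq, hYq⟩ := exists_approx_of_finset Y
    obtain ⟨r, hr, hpr, hqr⟩ := I.directed p hp q hq
    have h := hpr.2.2 _ (hYq.trans hqr.1)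
    have hpY : p.verts ⊆ Y.map (Function.Embedding.subtype _) :=
      hXp ▸ Finset.map_subset_map.2 hY
    rw [Finset.inter_eq_right.2 hpY, p.rank_verts] at h
    rw [hdX p hp X hXp, delta_eq_rank, hedges, rank_limitFam hr (hYq.trans hqr.1)]
    exact h
  · intro B hB
    obtain ⟨p, hp, hBp⟩ := exists_approx_of_finset B
    obtain ⟨X, hXp⟩ := hX p hp
    rw [← hXp] at hBp
    exact (strongIn_iff.1 hB X (Finset.map_subset_map.1 hBp)).trans_eq (hdX p hp X hXp)

theorem inKBar_limit [L.Structure (LimitVerts I)] (hH : IsHypergraph L (LimitVerts I))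
    (hedges : edges (L := L) (LimitVerts I) = limitFam I) : InKBar α (LimitVerts I) := by
  refine ⟨hH, fun X => ?_⟩
  obtain ⟨p, hp, hX⟩ := exists_approx_of_finset X
  rw [delta_eq_rank, hedges, rank_limitFam hp hX]
  exact p.rank_nonneg _ hX

/-- If every valid problem that is posed along the ideal is solved in it, the limit is a model. -/
theorem models_limit [L.IsRelational] [L.Structure (LimitVerts I)]
    (hM : InKBar α (LimitVerts I)) (hedges : edges (L := L) (LimitVerts I) = limitFam I)
    (hI : ∀ r : Problem L, r.Valid α → ∀ p ∈ I, (∀ q ∈ I, p ≤ q → r.Posed q) →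
      ∃ q ∈ I, r.Solved q) : LimitVerts I ⊨ S α := by
  classical
  rw [models_S_iff]
  refine ⟨fun A hA ⟨f⟩ => ⟨hA, hM.of_emb f⟩, ?_⟩
  rintro A B ⟨_, hA⟩ ⟨_, hB⟩ e he f
  let ε : B ≃ Fin (Nat.card B) := Finite.equivFin B
  let H : EdgeFamily (Σ n, L.Relations n) (Fin (Nat.card B)) :=
    fun E => {s | s.map ε.symm.toEmbedding ∈ edges (L := L) B E}
  have hε : IsEmb H (edges (L := L) B) ε.symm.toEmbedding := fun E s => Iff.rfl
  let k : A ↪ Fin (Nat.card B) := e.toEmbedding.trans ε.toEmbedding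
  have hkε : k.trans ε.symm.toEmbedding = e.toEmbedding := by
    ext a
    exact ε.symm_apply_apply (e a)
  have hk : IsEmb (edges (L := L) A) H k := by
    intro E s
    rw [← hε E, Finset.map_map, hkε, isEmb_edges e E]
  let f' : A ↪ ℕ := f.toEmbedding.trans (Function.Embedding.subtype _)
  let m : Fin (Nat.card B) → ℕ := fun x => if h : ∃ a, k a = x then f' h.choose else 0
  have hm : ∀ a, m (k a) = f' a := by
    intro a
    have h : ∃ a', k a' = k a := ⟨a, rfl⟩
    simp only [m, dif_pos h]
    rw [k.injective h.choose_spec]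
  let r : Problem L := ⟨Nat.card B, H, (whole A).map k, m⟩
  have hval : r.Valid α := by
    refine ⟨?_, ?_, ?_⟩
    · intro E s hs
      rw [← uniform_edges hB.1 E _ hs, Finset.card_map]
    · intro X
      rw [← rank_map α hε, ← delta_eq_rank]
      exact hB.2 _
    · intro Z hZ
      change rank α H ((whole A).map k) ≤ rank α H Z
      rw [← rank_map α hε, ← rank_map α hε, ← delta_eq_rank, ← delta_eq_rank, Finset.map_map, hkε]
      refine strongIn_iff.1 (isStrongEmb_iff.1 he) _ ?_
      rw [← hkε, ← Finset.map_map]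
      exact Finset.map_subset_map.2 hZ
  obtain ⟨p, hp, hpf⟩ := exists_approx_of_finset ((whole A).map f.toEmbedding)
  have hposed : ∀ q ∈ I, p ≤ q → r.Posed q := by
    intro q hq hpq
    have hfq : ∀ s : Finset A, (s.map f.toEmbedding).map (Function.Embedding.subtype _) ⊆
        q.verts := fun s =>
      (Finset.map_subset_map.2 (Finset.map_subset_map.2 fun a _ => mem_whole a)).trans
        (hpf.trans hpq.1)
    refine ⟨?_, ?_, ?_⟩
    · intro x hx
      obtain ⟨a, -, rfl⟩ := Finset.mem_map.1 hx
      change m (k a) ∈ _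
      rw [hm]
      exact hfq {a} (by simp [f'])
    · intro x hx y hy hxy
      obtain ⟨a, -, rfl⟩ := Finset.mem_map.1 (Finset.mem_coe.1 hx)
      obtain ⟨b, -, rfl⟩ := Finset.mem_map.1 (Finset.mem_coe.1 hy)
      change m (k a) = m (k b) at hxy
      rw [hm, hm] at hxy
      rw [f'.injective hxy]
    · intro E s hs
      obtain ⟨t, -, rfl⟩ := Finset.subset_map_iff.1 hs
      have h1 : (t.map k).image m =
          (t.map f.toEmbedding).map (Function.Embedding.subtype _) := by
        ext x
        simp only [Finset.mem_image, Finset.mem_map, exists_exists_and_eq_and]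
        exact exists_congr fun a => and_congr_right fun _ => by rw [hm]; rfl
      change (t.map k).image m ∈ q.fam E ↔ t.map k ∈ H E
      rw [h1, mem_limitFam_iff hq (hfq t) E, hk E, ← hedges, isEmb_edges f E]
  obtain ⟨q, hq, g, hg, hgq, hgm⟩ := hI r hval p hp hposed
  let G : B ↪ LimitVerts I :=
    ⟨fun b => ⟨g (ε b), q, hq, hgq (ε b)⟩, fun x y hxy =>
      ε.injective (g.injective (congrArg Subtype.val hxy))⟩
  have hG : IsEmb (edges (L := L) B) (edges (L := L) (LimitVerts I)) G := by
    intro E s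
    have h1 : (s.map G).map (Function.Embedding.subtype _) = (s.map ε.toEmbedding).map g := by
      rw [Finset.map_map, Finset.map_map]
      rfl
    have h2 : (s.map G).map (Function.Embedding.subtype _) ⊆ q.verts := by
      intro x hx
      rw [h1] at hx
      obtain ⟨y, -, rfl⟩ := Finset.mem_map.1 hx
      exact hgq y
    rw [hedges, ← mem_limitFam_iff hq h2 E, h1, hg E]
    change (s.map ε.toEmbedding).map ε.symm.toEmbedding ∈ edges (L := L) B E ↔ _
    rw [Finset.map_map]
    have h3 : ε.toEmbedding.trans ε.symm.toEmbedding = Function.Embedding.refl _ := by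
      ext b
      exact ε.symm_apply_apply b
    rw [h3, Finset.map_refl]
  refine ⟨embOfIsEmb hB.1 hM.1 G hG, Language.Embedding.ext fun a => Subtype.ext ?_⟩
  change g (k a) = f' a
  rw [← hm]
  exact hgm (k a) (Finset.mem_map.2 ⟨a, mem_whole a, rfl⟩)

end Limit

/-- The limit of an ideal of approximations that meets, for each of the countably many problems, the
cofinal set of approximations deciding it. -/
theorem exists_model_dim_eq [L.IsRelational] (har : ∀ E : (Σ n, L.Relations n), 2 ≤ E.1)
    [Nonempty (Σ n, L.Relations n)] (hα : ∀ E, 0 < α E ∧ α E < 1) (n : ℕ) :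
    ∃ (M : Type) (_ : L.Structure M), Countable M ∧ M ⊨ S α ∧
      dim α M = ((n : ℚ) : WithTop ℚ) := by
  classical
  have hr : ∀ X : Finset ℕ, rank α (fun _ => ∅ : EdgeFamily (Σ n, L.Relations n) ℕ) X = X.card := by
    intro X
    simp [rank, count]
  let p₀ : Approx (L := L) α n :=
    { verts := Finset.range n
      fam := fun _ => ∅
      uniform := fun _ _ h => (Set.notMem_empty _ h).elim
      rank_nonneg := fun X _ => by rw [hr]; positivity
      rank_verts := by rw [hr, Finset.card_range] }
  have := Encodable.ofCountable (Problem L)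
  -- Below any approximation, a problem is either solved or never posed again.
  let cof : Problem L → Order.Cofinal (Approx (L := L) α n) := fun r =>
    ⟨{p | r.Valid α → r.Solved p ∨ ∀ q, p ≤ q → ¬ r.Posed q}, fun p => by
      by_cases h : r.Valid α ∧ ∃ q, p ≤ q ∧ r.Posed q
      · obtain ⟨hval, q, hpq, hq⟩ := h
        obtain ⟨q', hqq', hq'⟩ := Problem.exists_solved har hα hval hq
        exact ⟨q', fun _ => Or.inl hq', hpq.trans hqq'⟩
      · exact ⟨p, fun hval => Or.inr fun q hpq hq => h ⟨hval, q, hpq, hq⟩, le_rfl⟩⟩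
  let I := Order.idealOfCofinals p₀ cof
  let _ : L.Structure (LimitVerts I) := ofHypergraph (limitFam I)
  have hH : IsHypergraph L (LimitVerts I) := isHypergraph_ofHypergraph _
  have hedges : edges (L := L) (LimitVerts I) = limitFam I := edges_ofHypergraph uniform_limitFam
  have hM := inKBar_limit hH hedges
  refine ⟨LimitVerts I, inferInstance, inferInstance, models_limit hM hedges ?_,
    dim_limit har hM hedges⟩
  intro r hval p hp hposed
  obtain ⟨q, hq, hqI⟩ := Order.cofinal_meets_idealOfCofinals p₀ cof r
  rcases hq hval with hs | hn
  · exact ⟨q, hqI, hs⟩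
  · obtain ⟨q', hq', hpq', hqq'⟩ := I.directed p hp q hqI
    exact absurd (hposed q' hq' hpq') (hn q' hqq')

/-! ### Countable models up to isomorphism -/

theorem infinite_of_models [L.IsRelational] (har : ∀ E : (Σ n, L.Relations n), 2 ≤ E.1)
    {M : Type w} [L.Structure M] (hM : M ⊨ S α) : Infinite M := by
  obtain ⟨A, _, hA, hcard, -⟩ := exists_free_points (L := L) (α := α) 0
  have : IsEmpty A := (Finite.card_eq_zero_iff).1 hcard
  obtain ⟨f, -⟩ := exists_strongEmb_of_isEmpty har hA.1 (inKBar_of_models hM)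
  refine not_finite_iff_infinite.1 fun hfin => ?_
  obtain ⟨B, _, hB, hcardB, -⟩ := exists_free_points (L := L) (α := α) (Nat.card M + 1)
  obtain ⟨e, he⟩ := exists_strongEmb_of_isEmpty har hA.1 hB
  obtain ⟨g, -⟩ := exists_extension_of_models hM hB he f
  have := Nat.card_le_card_of_injective g g.injective
  omega

theorem nonempty_equiv_iff_dim_eq [L.IsRelational] (har : ∀ E : (Σ n, L.Relations n), 2 ≤ E.1)
    [Nonempty (Σ n, L.Relations n)] (hα : ∀ E, 0 < α E ∧ α E < 1) {M N : Type w} [L.Structure M]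
    [L.Structure N] [Countable M] [Countable N] (hM : M ⊨ S α) (hN : N ⊨ S α) :
    Nonempty (M ≃[L] N) ↔ dim α M = dim α N := by
  have hα0 : ∀ E, 0 ≤ α E := fun E => (hα E).1.le
  refine ⟨fun ⟨e⟩ => dim_congr har (inKBar_of_models hM) (inKBar_of_models hN) e, fun h => ?_⟩
  by_cases htop : dim α M = ⊤
  · exact nonempty_equiv_of_isGeneric hα0 (isFraisseClass_K har hα0)
      (isGeneric_K_of_models har hα hM htop) (isGeneric_K_of_models har hα hN (h ▸ htop))
  · obtain ⟨k, hk⟩ := exists_coe_of_dim_ne_top har (inKBar_of_models hM) htop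
    exact nonempty_equiv_of_isGeneric hα0 (isFraisseClass_KRank har hα k)
      (isGeneric_KRank_of_models har hM hk) (isGeneric_KRank_of_models har hN (h ▸ hk))

theorem mk_quotient_countableModels [L.IsRelational] (har : ∀ E : (Σ n, L.Relations n), 2 ≤ E.1)
    [Nonempty (Σ n, L.Relations n)] (hα : ∀ E, 0 < α E ∧ α E < 1) :
    Cardinal.mk (Quotient (countableModelsSetoid.{u, v, w} α)) = Cardinal.aleph0 := by
  have hiff : ∀ M N : {M : Bundled.{w} L.Structure // Cardinal.mk M = Cardinal.aleph0 ∧ M ⊨ S α},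
      (countableModelsSetoid.{u, v, w} α).r M N ↔ dim α M.1 = dim α N.1 := by
    intro M N
    have : Countable M.1 := Cardinal.mk_le_aleph0_iff.1 M.2.1.le
    have : Countable N.1 := Cardinal.mk_le_aleph0_iff.1 N.2.1.le
    exact nonempty_equiv_iff_dim_eq har hα M.2.2 N.2.2
  apply le_antisymm
  · let F : Quotient (countableModelsSetoid.{u, v, w} α) → WithTop ℚ :=
      Quotient.lift (fun M => dim α M.1) fun M N h => (hiff M N).1 h
    have hF : Function.Injective F := by
      rintro ⟨M⟩ ⟨N⟩ h
      exact Quotient.sound ((hiff M N).2 h)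
    have : Countable (WithTop ℚ) := inferInstanceAs (Countable (Option ℚ))
    exact Cardinal.mk_le_aleph0_iff.2 hF.countable
  · have hex : ∀ n : ℕ, ∃ M : {M : Bundled.{w} L.Structure //
        Cardinal.mk M = Cardinal.aleph0 ∧ M ⊨ S α}, dim α M.1 = ((n : ℚ) : WithTop ℚ) := by
      intro n
      obtain ⟨M, _, _, hM, hd⟩ := exists_model_dim_eq har hα n
      let _ : L.Structure (ULift.{w} M) := Equiv.ulift.symm.inducedStructure
      let e : M ≃[L] ULift.{w} M := Equiv.inducedStructureEquiv Equiv.ulift.symm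
      have hN : ULift.{w} M ⊨ S α := Language.StrongHomClass.theory_model e
      have : Infinite (ULift.{w} M) := infinite_of_models har hN
      exact ⟨⟨⟨ULift.{w} M, inferInstance⟩, Cardinal.mk_eq_aleph0 _, hN⟩,
        (dim_congr har (inKBar_of_models hM) (inKBar_of_models hN) e).symm.trans hd⟩
    choose M hM using hex
    have hinj : Function.Injective fun n =>
        (Quotient.mk (countableModelsSetoid.{u, v, w} α) (M n)) := by
      intro m n hmn
      have h := (hiff _ _).1 (Quotient.exact hmn)
      rw [hM, hM] at h
      exact_mod_cast h
    have : Infinite (Quotient (countableModelsSetoid.{u, v, w} α)) := Infinite.of_injective _ hinj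
    exact Cardinal.aleph0_le_mk _

end

end BaldwinShi

theorem theorem4p5 (L : FirstOrder.Language.{u, v}) [L.IsRelational]
    [Fintype (Σ n, L.Relations n)] [Nonempty (Σ n, L.Relations n)]
    (har : ∀ E : (Σ n, L.Relations n), 2 ≤ E.1)
    (α : (Σ n, L.Relations n) → ℚ) (hα : ∀ E, 0 < α E ∧ α E < 1) :
    -- isomorphism is equality of dimension
    (∀ (M N : Type w) [L.Structure M] [L.Structure N] [Countable M] [Countable N],
      M ⊨ BaldwinShi.S α → N ⊨ BaldwinShi.S α →
      (Nonempty (M ≃[L] N) ↔ BaldwinShi.dim α M = BaldwinShi.dim α N)) ∧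
    -- dimension `∞` characterizes the generic of `K_α`
    (∀ (M : Type w) [L.Structure M] [Countable M], M ⊨ BaldwinShi.S α →
      (BaldwinShi.dim α M = ⊤ ↔ BaldwinShi.IsGeneric α (BaldwinShi.K α) M)) ∧
    -- there are exactly `ℵ₀` isomorphism classes of countable models
    Cardinal.mk (Quotient (BaldwinShi.countableModelsSetoid.{u, v, w} α)) = Cardinal.aleph0 ∧
    -- every countable model is the generic of a subclass of `(K_α, ≤)`
    (∀ (M : Type w) [L.Structure M] [Countable M], M ⊨ BaldwinShi.S α →
      ∃ C : Set (CategoryTheory.Bundled.{0} L.Structure), C ⊆ BaldwinShi.K α ∧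
        BaldwinShi.IsFraisseClass α C ∧ BaldwinShi.IsGeneric α C M ∧
        ((BaldwinShi.dim α M = ⊤ ∧ C = BaldwinShi.K α) ∨
          ∃ k : ℕ, BaldwinShi.dim α M =
              (((k : ℚ) / (BaldwinShi.commonDenom α : ℚ) : ℚ) : WithTop ℚ) ∧
            C = BaldwinShi.KRank α k)) := by
  refine ⟨fun M N _ _ _ _ hM hN => BaldwinShi.nonempty_equiv_iff_dim_eq har hα hM hN,
    fun M _ _ hM => ⟨BaldwinShi.isGeneric_K_of_models har hα hM,
      BaldwinShi.dim_eq_top_of_isGeneric har⟩,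
    BaldwinShi.mk_quotient_countableModels har hα, fun M _ _ hM => ?_⟩
  by_cases htop : BaldwinShi.dim α M = ⊤
  · exact ⟨_, subset_rfl, BaldwinShi.isFraisseClass_K har fun E => (hα E).1.le,
      BaldwinShi.isGeneric_K_of_models har hα hM htop, Or.inl ⟨htop, rfl⟩⟩
  · obtain ⟨k, hk⟩ := BaldwinShi.exists_coe_of_dim_ne_top har (BaldwinShi.inKBar_of_models hM) htop
    exact ⟨_, BaldwinShi.KRank_subset k, BaldwinShi.isFraisseClass_KRank har hα k,
      BaldwinShi.isGeneric_KRank_of_models har hM hk, Or.inr ⟨k, hk, rfl⟩⟩
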